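/- For $\eta>0$ and $\delta\in(0,1)$, $\textsc{Gap-SSE}(\eta,\delta)$ is the following promise problem. The input is a $d$-regular graph $G=(V,E)$ (with $d\ge 1$, $V\neq\varnothing$ and $\delta|V|$ an integer). It is a yes-instance if $\phi_G(\delta)\le\eta$ and a no-instance if $\phi_G(\delta)\ge 1-\eta$, where $$\phi_G(\delta)=\min_{S\subseteq V,\ |S|=\delta|V|}\frac{|E(S,V\setminus S)|}{d|S|}.$$ The Small-Set Expansion Hypothesis (SSE) says that for every $\eta>0$ there is a $\delta\in(0,1)$ such that $\textsc{Gap-SSE}(\eta,\delta)$ is $\mathcal{NP}$-hard. Consider the problem of maximizing a non-negative monotone set function $f$ on a ground set of size $n$ subject to a uniform matroid constraint: given $n$, $k\le n$ and a value oracle for $f$, find a set $S$ with $|S|\le k$; the algorithm has approximation ratio $c$ if always $f(S)\ge c\cdot\max_{|T|\le k}f(T)$. **Theorem.** Assume SSE. Then, for every constant $c>0$, no (deterministic) polynomial-time algorithm has approximation ratio $c$ for this problem, even if all values of $f$ are natural numbers (written in binary) and the running time may be polynomial in $n$ and in the maximal bit length of the values of $f$. Moreover, if $\mathcal{P}\neq\mathcal{NP}$,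 then this remains true when $f$ is restricted to the functions $f(S)=|\{e\in E: e\subseteq S\}|$ that count the edges of a graph $G=(V,E)$ induced by a set $S\subseteq V$ of its vertices. -/

import Mathlib

namespace SSEHardness

/-! ### Machine model: multi-stack machines with a step count -/

/-- Contents of the registers of a machine. Each register holds a bit string and is accessed as
a stack, whose top is the head of the list. -/
abbrev Store := ℕ → List Bool

/-- Programs of a deterministic multi-stack machine over the binary alphabet with an oracle.
A program mentions finitely many registers and each elementary instruction touches one symbol on
top of one stack, so (oracle queries apart) this is the multi-tape Turing machine model up to a
polynomial overhead. -/
inductive Prog : Type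
  /-- do nothing -/
  | skip : Prog
  /-- put the bit `b` on top of register `r` -/
  | push (r : ℕ) (b : Bool) : Prog
  /-- remove the top bit of register `r`, if there is one -/
  | pop (r : ℕ) : Prog
  /-- sequential composition -/
  | seq (p q : Prog) : Prog
  /-- run `p₀`, `p₁` or `p₂` according to whether register `r` is empty, has top bit `false`,
  or has top bit `true` -/
  | branch (r : ℕ) (p₀ p₁ p₂ : Prog) : Prog
  /-- while register `r` is nonempty, run `p` -/
  | loop (r : ℕ) (p : Prog) : Prog
  /-- ask the oracle about the string in register `q`; its answer replaces the contents of
  register `a` -/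
  | query (q a : ℕ) : Prog

/-- `Exec O p s s' t`: with the oracle `O`, the program `p` started in the store `s` halts in the
store `s'` after exactly `t` elementary steps. Every instruction, test and oracle query costs one
step. -/
inductive Exec (O : List Bool → List Bool) : Prog → Store → Store → ℕ → Prop
  | skip (s : Store) : Exec O .skip s s 1
  | push (s : Store) (r : ℕ) (b : Bool) :
      Exec O (.push r b) s (Function.update s r (b :: s r)) 1
  | pop (s : Store) (r : ℕ) :
      Exec O (.pop r) s (Function.update s r (s r).tail) 1
  | seq {p q : Prog} {s s' s'' : Store} {t t' : ℕ} :
      Exec O p s s' t → Exec O q s' s'' t' → Exec O (.seq p q) s s'' (t + t')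
  | branch_nil {r : ℕ} {p₀ p₁ p₂ : Prog} {s s' : Store} {t : ℕ} :
      s r = [] → Exec O p₀ s s' t → Exec O (.branch r p₀ p₁ p₂) s s' (t + 1)
  | branch_false {r : ℕ} {p₀ p₁ p₂ : Prog} {s s' : Store} {t : ℕ} {l : List Bool} :
      s r = false :: l → Exec O p₁ s s' t → Exec O (.branch r p₀ p₁ p₂) s s' (t + 1)
  | branch_true {r : ℕ} {p₀ p₁ p₂ : Prog} {s s' : Store} {t : ℕ} {l : List Bool} :
      s r = true :: l → Exec O p₂ s s' t → Exec O (.branch r p₀ p₁ p₂) s s' (t + 1)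
  | loop_done {r : ℕ} {p : Prog} {s : Store} :
      s r = [] → Exec O (.loop r p) s s 1
  | loop_step {r : ℕ} {p : Prog} {s s' s'' : Store} {t t' : ℕ} :
      s r ≠ [] → Exec O p s s' t → Exec O (.loop r p) s' s'' t' →
        Exec O (.loop r p) s s'' (t + t' + 1)
  | query (s : Store) (q a : ℕ) :
      Exec O (.query q a) s (Function.update s a (O (s q))) 1

/-- The initial store: the input strings are in registers `0, 1, …`, all others are empty. -/
def initStore (inputs : List (List Bool)) : Store := fun r => inputs.getD r []

/-- The trivial oracle. Computations without an oracle are those that use this one. -/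
def noOracle : List Bool → List Bool := fun _ => []

/-- Without an oracle, `p` halts on the given inputs within `T` steps with output `y`
(the final contents of register `0`). -/
def OutputsWithin (p : Prog) (inputs : List (List Bool)) (y : List Bool) (T : ℕ) : Prop :=
  ∃ s t, Exec noOracle p (initStore inputs) s t ∧ t ≤ T ∧ s 0 = y

/-! ### The classes P and NP, and NP-hardness of promise problems -/

/-- `F` is computable in polynomial time. -/
def PolyTimeComputable (F : List Bool → List Bool) : Prop :=
  ∃ (p : Prog) (q : Polynomial ℕ), ∀ x, OutputsWithin p [x] (F x) (q.eval x.length)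

/-- The class P. A machine accepts with output `[true]`. -/
def classP : Set (Set (List Bool)) :=
  {L | ∃ F, PolyTimeComputable F ∧ ∀ x, x ∈ L ↔ F x = [true]}

/-- The class NP: languages with certificates of polynomial length that are verified in polynomial
time. The verifier gets the input and the certificate in two registers. -/
def classNP : Set (Set (List Bool)) :=
  {L | ∃ (p : Prog) (q : Polynomial ℕ) (V : List Bool → List Bool → List Bool),
    (∀ x w, w.length ≤ q.eval x.length → OutputsWithin p [x, w] (V x w) (q.eval x.length)) ∧
    ∀ x, x ∈ L ↔ ∃ w, w.length ≤ q.eval x.length ∧ V x w = [true]}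

/-- A promise problem: its yes-instances and its no-instances. -/
structure PromiseProblem where
  yes : Set (List Bool)
  no : Set (List Bool)

/-- Every language in NP has a polynomial-time many-one reduction to the promise problem. -/
def NPHard (A : PromiseProblem) : Prop :=
  ∀ L ∈ classNP, ∃ F, PolyTimeComputable F ∧ ∀ x, (x ∈ L → F x ∈ A.yes) ∧ (x ∉ L → F x ∈ A.no)

/-! ### The Small-Set Expansion Hypothesis -/

open Classical in
/-- The edge expansion of a vertex set `S`: the number of edges between `S` and its complement,
divided by the sum of the degrees in `S` (which is `d * |S|` in a `d`-regular graph). -/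
noncomputable def edgeExpansion {n : ℕ} (G : SimpleGraph (Fin n)) (S : Finset (Fin n)) : ℝ :=
  ((G.interedges S Sᶜ).card : ℝ) / ∑ v ∈ S, (G.degree v : ℝ)

/-- The edge expansion of `G` with respect to vertex sets of size exactly `δ * n`. -/
noncomputable def smallSetExpansion {n : ℕ} (G : SimpleGraph (Fin n)) (δ : ℝ) : ℝ :=
  ⨅ S : {S : Finset (Fin n) // (S.card : ℝ) = δ * n}, edgeExpansion G S.1

open Classical in
/-- The graphs `G` for which the small-set expansion at `δ` makes sense: nonempty, regular of
positive degree, with `δ * n` an integer. -/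
def IsSSEInstance {n : ℕ} (G : SimpleGraph (Fin n)) (δ : ℝ) : Prop :=
  0 < n ∧ (∃ d : ℕ, 0 < d ∧ G.IsRegularOfDegree d) ∧ ∃ m : ℕ, (m : ℝ) = δ * n

open Classical in
/-- A graph as a bit string: the number of vertices in unary, a separator, and the rows of the
adjacency matrix. -/
noncomputable def encodeGraph {n : ℕ} (G : SimpleGraph (Fin n)) : List Bool :=
  List.replicate n true ++ false ::
    (List.finRange n).flatMap fun i => (List.finRange n).map fun j => decide (G.Adj i j)

/-- The Gap Small-Set Expansion problem with parameters `η` and `δ`. -/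
def gapSSE (η δ : ℝ) : PromiseProblem where
  yes := {x | ∃ (n : ℕ) (G : SimpleGraph (Fin n)),
    x = encodeGraph G ∧ IsSSEInstance G δ ∧ smallSetExpansion G δ ≤ η}
  no := {x | ∃ (n : ℕ) (G : SimpleGraph (Fin n)),
    x = encodeGraph G ∧ IsSSEInstance G δ ∧ 1 - η ≤ smallSetExpansion G δ}

/-- The Small-Set Expansion Hypothesis. -/
def SmallSetExpansionHypothesis : Prop :=
  ∀ η : ℝ, 0 < η → ∃ δ : ℝ, 0 < δ ∧ δ < 1 ∧ NPHard (gapSSE η δ)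

/-! ### Maximizing a set function subject to a uniform matroid constraint -/

/-- The subset of the ground set `Fin n` with the given characteristic string (padded with
`false`, or cut, if its length is not `n`). -/
def decodeSet (n : ℕ) (x : List Bool) : Finset (Fin n) :=
  Finset.univ.filter fun i => x.getD i false = true

/-- The value oracle of `f`: given a subset, it returns the value of `f` in binary. -/
def valueOracle {n : ℕ} (f : Finset (Fin n) → ℕ) : List Bool → List Bool :=
  fun x => (f (decodeSet n x)).bits

/-- The maximal bit length of a value of `f`. -/
def valueBits {n : ℕ} (f : Finset (Fin n) → ℕ) : ℕ :=
  Finset.univ.sup fun S => (f S).bits.length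

/-- `S` is a `c`-approximate maximizer of `f` over the independent sets of the uniform matroid of
rank `k`, that is, over the sets of size at most `k`. -/
def IsApproxMaximizer {n : ℕ} (f : Finset (Fin n) → ℕ) (k : ℕ) (c : ℝ) (S : Finset (Fin n)) :
    Prop :=
  S.card ≤ k ∧ ∀ T : Finset (Fin n), T.card ≤ k → c * (f T : ℝ) ≤ (f S : ℝ)

/-- A class of set functions with values in the natural numbers, on every ground set `Fin n`. -/
abbrev SetFunctionClass := (n : ℕ) → Set (Finset (Fin n) → ℕ)

/-- All monotone set functions. -/
def monotoneSetFunctions : SetFunctionClass := fun _ => {f | Monotone f}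

/-- The set functions that count the edges of a graph inside the given set of vertices. -/
def inducedEdgeCounts : SetFunctionClass := fun n =>
  {f | ∃ G : SimpleGraph (Fin n), ∀ S, f S = {e ∈ G.edgeSet | ∀ v ∈ e, v ∈ S}.ncard}

/-- There is a polynomial-time value-oracle algorithm that, for each `f` in the class and each
`k ≤ n` (both `n` and `k` being given in unary), returns a `c`-approximate maximizer of `f` subject
to the uniform matroid constraint of rank `k`. The running time may be polynomial in `n` and in the
bit length of the values of `f`. -/
def HasPolyTimeApprox (C : SetFunctionClass) (c : ℝ) : Prop :=
  ∃ (p : Prog) (q : Polynomial ℕ), ∀ (n k : ℕ) (f : Finset (Fin n) → ℕ), k ≤ n → f ∈ C n →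
    ∃ (s : Store) (t : ℕ),
      Exec (valueOracle f) p (initStore [List.replicate n true, List.replicate k true]) s t ∧
      t ≤ q.eval (n + valueBits f) ∧ IsApproxMaximizer f k c (decodeSet n (s 0))

end SSEHardness

/-!
The two halves of the theorem have different reasons.

For all monotone functions, an adversary argument works without any complexity assumption. Let `f`
be one on the sets of more than `k` elements and zero on all others, and let `f_T` differ from `f`
only in being one on a single `k`-set `T`. A run on `f` in `t` steps depends on at most `t` oracle
values (`Exec.exists_queries`), and for `n = 2 * k` there are more than polynomially many `k`-sets.
So some `T` is neither queried nor returned; the run on `f_T` is the same and its result has value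
zero, although the optimum is one (`not_hasPolyTimeApprox_monotoneSetFunctions`).

For numbers of induced edges, let `η = 1 / M` with `c * (M - 1) > 1`. In a `d`-regular graph a set
`S` of size `δ * n` with expansion `φ` spans `(1 - φ) * d * |S| / 2` edges
(`two_mul_edgesWithin_eq`). In a yes-instance of Gap-SSE some set of size `δ * n` therefore spans at
least a fraction `(1 - η) * δ` of all edges, and a `c`-approximate maximizer spans more than a
fraction `δ / M` of them; in a no-instance no set of size at most `δ * n` spans more than this
fraction. Hence the reduction of a language in NP to Gap-SSE, followed by the approximation
algorithm and one comparison, decides the language (`classNP_subset_classP`). With P ⊆ NP this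
contradicts P ≠ NP.

Most of the text shows that this decision procedure is a polynomial-time program of the machine
model. A program is simulated on renamed registers with subroutines in place of oracle queries
(`runs_translate`). The subroutine evaluates the quadratic form of the adjacency matrix at the
characteristic vector of the queried set, which is twice the number of induced edges
(`bilinear_adjRows`), and writes half of it in binary (`runs_answerProg`). It reads only the first
`n` bits of the query, so its cost is bounded in terms of `n` alone. The size `δ * n` is computable
because `δ` is rational as soon as one instance exists.
-/

namespace SSEHardness

/-! ### Running programs without an oracle -/

/-- Without an oracle, `p` leads from the store `S` to the store `S'` within `T` steps. -/
def Runs (p : Prog) (S S' : Store) (T : ℕ) : Prop := ∃ t, t ≤ T ∧ Exec noOracle p S S' t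

/-- Sequential composition of programs. -/
infixr:65 " ⨾ " => Prog.seq

namespace Runs

theorem congr {p : Prog} {S S' S'' : Store} {T T' : ℕ} (h : Runs p S S' T) (hS : S' = S'')
    (hT : T ≤ T') : Runs p S S'' T' := by
  obtain ⟨t, ht, h⟩ := h
  exact ⟨t, ht.trans hT, hS ▸ h⟩

theorem mono {p : Prog} {S S' : Store} {T T' : ℕ} (h : Runs p S S' T) (hT : T ≤ T') :
    Runs p S S' T' := h.congr rfl hT

theorem seq {p q : Prog} {S S' S'' : Store} {T T' : ℕ} (h : Runs p S S' T)
    (h' : Runs q S' S'' T') : Runs (p ⨾ q) S S'' (T + T') := by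
  obtain ⟨t, ht, h⟩ := h
  obtain ⟨t', ht', h'⟩ := h'
  exact ⟨t + t', by omega, h.seq h'⟩

theorem skip (S : Store) : Runs .skip S S 1 := ⟨1, le_rfl, .skip S⟩

theorem push (S : Store) (r : ℕ) (b : Bool) :
    Runs (.push r b) S (Function.update S r (b :: S r)) 1 := ⟨1, le_rfl, .push S r b⟩

theorem pop (S : Store) (r : ℕ) :
    Runs (.pop r) S (Function.update S r (S r).tail) 1 := ⟨1, le_rfl, .pop S r⟩

/-- Querying the trivial oracle empties the answer register in a single step. -/
theorem clear (S : Store) (q a : ℕ) : Runs (.query q a) S (Function.update S a []) 1 :=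
  ⟨1, le_rfl, .query S q a⟩

theorem branch_nil {r : ℕ} {p₀ p₁ p₂ : Prog} {S S' : Store} {T : ℕ} (hr : S r = [])
    (h : Runs p₀ S S' T) : Runs (.branch r p₀ p₁ p₂) S S' (T + 1) := by
  obtain ⟨t, ht, h⟩ := h
  exact ⟨t + 1, by omega, .branch_nil hr h⟩

theorem branch_false {r : ℕ} {p₀ p₁ p₂ : Prog} {S S' : Store} {T : ℕ} {l : List Bool}
    (hr : S r = false :: l) (h : Runs p₁ S S' T) : Runs (.branch r p₀ p₁ p₂) S S' (T + 1) := by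
  obtain ⟨t, ht, h⟩ := h
  exact ⟨t + 1, by omega, .branch_false hr h⟩

theorem branch_true {r : ℕ} {p₀ p₁ p₂ : Prog} {S S' : Store} {T : ℕ} {l : List Bool}
    (hr : S r = true :: l) (h : Runs p₂ S S' T) : Runs (.branch r p₀ p₁ p₂) S S' (T + 1) := by
  obtain ⟨t, ht, h⟩ := h
  exact ⟨t + 1, by omega, .branch_true hr h⟩

theorem loop_done {r : ℕ} {p : Prog} {S : Store} (hr : S r = []) : Runs (.loop r p) S S 1 :=
  ⟨1, le_rfl, .loop_done hr⟩

theorem loop_step {r : ℕ} {p : Prog} {S S' S'' : Store} {T T' : ℕ} (hr : S r ≠ [])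
    (h : Runs p S S' T) (h' : Runs (.loop r p) S' S'' T') :
    Runs (.loop r p) S S'' (T + T' + 1) := by
  obtain ⟨t, ht, h⟩ := h
  obtain ⟨t', ht', h'⟩ := h'
  exact ⟨t + t' + 1, by omega, .loop_step hr h h'⟩

end Runs

/-! ### Moving and scaling register contents -/

/-- Run `bit b` with the top bit `b` of register `r` after removing it. -/
def withTop (r : ℕ) (bit : Bool → Prog) : Prog :=
  .branch r .skip (.pop r ⨾ bit false) (.pop r ⨾ bit true)

theorem runs_withTop {r : ℕ} {bit : Bool → Prog} {S S' : Store} {T : ℕ} {b : Bool}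
    {l : List Bool} (hr : S r = b :: l) (h : Runs (bit b) (Function.update S r l) S' T) :
    Runs (withTop r bit) S S' (T + 2) := by
  have hpop : Runs (.pop r) S (Function.update S r l) 1 := by
    simpa [hr] using Runs.pop S r
  cases b
  · exact (Runs.branch_false hr (hpop.seq h)).mono (by omega)
  · exact (Runs.branch_true hr (hpop.seq h)).mono (by omega)

/-- Move the contents of register `r` on top of register `r'`, which reverses their order. -/
def moveAll (r r' : ℕ) : Prog := .loop r (withTop r fun b => .push r' b)

theorem runs_moveAll {r r' : ℕ} (hne : r ≠ r') (S : Store) :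
    Runs (moveAll r r') S
      (Function.update (Function.update S r []) r' ((S r).reverse ++ S r'))
      (4 * (S r).length + 1) := by
  obtain ⟨l, hl⟩ : ∃ l, S r = l := ⟨_, rfl⟩
  induction l generalizing S with
  | nil =>
    refine (Runs.loop_done hl).congr ?_ (by omega)
    funext x
    by_cases h : x = r' <;> by_cases h' : x = r <;> simp_all
  | cons b l ih =>
    have h1 : Runs (withTop r fun b => .push r' b) S _ _ :=
      runs_withTop hl (Runs.push (Function.update S r l) r' b)
    refine (Runs.loop_step (by simp [hl]) h1 (ih _ (by simp [hne]))).congr ?_ ?_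
    · funext x
      by_cases h : x = r' <;> by_cases h' : x = r <;> simp_all [hne.symm]
    · simp [hl, hne]
      omega

/-- Run the program `p` repeatedly, `m` times. -/
def repeatProg (p : Prog) : ℕ → Prog
  | 0 => .skip
  | m + 1 => p ⨾ repeatProg p m

theorem runs_repeat_pop (S : Store) (r m : ℕ) :
    Runs (repeatProg (.pop r) m) S (Function.update S r ((S r).drop m)) (2 * m + 1) := by
  induction m generalizing S with
  | zero => simpa [repeatProg] using Runs.skip S
  | succ m ih => exact ((Runs.pop S r).seq (ih _)).congr (by simp) (by omega)

theorem runs_repeat_push (S : Store) (r m : ℕ) :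
    Runs (repeatProg (.push r true) m) S
      (Function.update S r (List.replicate m true ++ S r)) (2 * m + 1) := by
  induction m generalizing S with
  | zero => simpa [repeatProg] using Runs.skip S
  | succ m ih =>
    refine ((Runs.push S r true).seq (ih _)).congr ?_ (by omega)
    have : ∀ l : List Bool, List.replicate m true ++ true :: l
        = List.replicate (m + 1) true ++ l := fun l => by
      rw [List.replicate_succ']; simp
    simp [this]

/-- Multiply a unary number in register `r` by the rational number `a / b`; the result is put on
top of register `r'`. -/
def scaleProg (r r' a b : ℕ) : Prog :=
  .loop r (repeatProg (.pop r) b ⨾ repeatProg (.push r' true) a)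

theorem runs_scaleProg {r r' : ℕ} (hne : r ≠ r') (a : ℕ) {b : ℕ} (hb : 0 < b) (j : ℕ) (S : Store)
    (hS : S r = List.replicate (b * j) true) :
    Runs (scaleProg r r' a b) S
      (Function.update (Function.update S r []) r' (List.replicate (a * j) true ++ S r'))
      ((2 * a + 2 * b + 3) * j + 1) := by
  induction j generalizing S with
  | zero =>
    refine (Runs.loop_done (by simpa using hS)).congr ?_ (by omega)
    funext x
    by_cases h : x = r' <;> by_cases h' : x = r <;> simp_all
  | succ j ih =>
    have hpos : 0 < b * (j + 1) := by positivity
    have h1 := (runs_repeat_pop S r b).seq (runs_repeat_push _ r' a)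
    refine (Runs.loop_step ?_ h1 (ih _ ?_)).congr ?_ ?_
    · rw [hS]
      simp [hb.ne']
    · simp [hne, hS, mul_add]
    · funext x
      have : List.replicate (a * j) true ++ (List.replicate a true ++ S r')
          = List.replicate (a * (j + 1)) true ++ S r' := by
        rw [← List.append_assoc, List.replicate_append_replicate, mul_add, mul_one]
      by_cases h : x = r' <;> by_cases h' : x = r <;> simp_all [hne.symm]
    · ring_nf
      omega

/-- Subtract `a` times the unary number in register `r` from the one in register `r'`. -/
def subtractProg (r r' a : ℕ) : Prog :=
  .loop r (.pop r ⨾ repeatProg (.pop r') a)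

theorem runs_subtractProg {r r' : ℕ} (hne : r ≠ r') (a j : ℕ) (S : Store)
    (hS : S r = List.replicate j true) :
    Runs (subtractProg r r' a) S
      (Function.update (Function.update S r []) r' ((S r').drop (a * j)))
      ((2 * a + 3) * j + 1) := by
  induction j generalizing S with
  | zero =>
    refine (Runs.loop_done (by simpa using hS)).congr ?_ (by omega)
    funext x
    by_cases h : x = r' <;> by_cases h' : x = r <;> simp_all
  | succ j ih =>
    have h1 := (Runs.pop S r).seq (runs_repeat_pop _ r' a)
    refine (Runs.loop_step ?_ h1 (ih _ ?_)).congr ?_ ?_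
    · simp [hS]
    · simp [hne, hS]
    · funext x
      by_cases h : x = r' <;> by_cases h' : x = r <;> simp_all [hne.symm, mul_add, add_comm]
    · ring_nf
      omega

/-! ### Simulating a program on other registers -/

/-- The program `p` with its registers renamed by `ρ` and with a subroutine in place of each
oracle query. -/
def translate (ρ : ℕ → ℕ) (sub : ℕ → ℕ → Prog) : Prog → Prog
  | .skip => .skip
  | .push r b => .push (ρ r) b
  | .pop r => .pop (ρ r)
  | .seq p q => .seq (translate ρ sub p) (translate ρ sub q)
  | .branch r p₀ p₁ p₂ =>
      .branch (ρ r) (translate ρ sub p₀) (translate ρ sub p₁) (translate ρ sub p₂)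
  | .loop r p => .loop (ρ r) (translate ρ sub p)
  | .query q a => sub q a

/-- A computation with oracle `O` is simulated without an oracle, on renamed registers, once a
subroutine of cost at most `D` answers the queries. The subroutine may rely on an invariant `I` that
is insensitive to the renamed registers. -/
theorem runs_translate {O : List Bool → List Bool} {ρ : ℕ → ℕ} (hρ : Function.Injective ρ)
    {sub : ℕ → ℕ → Prog} {D : ℕ} (hD : 1 ≤ D) {I : Store → Prop}
    (hI : ∀ S r v, I S → I (Function.update S (ρ r) v))
    (hsub : ∀ q a S, I S →
      Runs (sub q a) S (Function.update S (ρ a) (O (S (ρ q)))) D)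
    {p : Prog} {s s' : Store} {t : ℕ} (h : Exec O p s s' t) :
    ∀ S, I S → S ∘ ρ = s →
      ∃ S', I S' ∧ S' ∘ ρ = s' ∧ Runs (translate ρ sub p) S S' (D * t) := by
  have upd : ∀ (S : Store) (r : ℕ) (v : List Bool),
      Function.update S (ρ r) v ∘ ρ = Function.update (S ∘ ρ) r v := fun S r v =>
    Function.update_comp_eq_of_injective S hρ r v
  induction h with
  | skip s => exact fun S hS hs => ⟨S, hS, hs, (Runs.skip S).mono (by omega)⟩
  | push s r b =>
    rintro S hS rfl
    exact ⟨_, hI _ _ _ hS, upd _ _ _, (Runs.push S (ρ r) b).mono (by omega)⟩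
  | pop s r =>
    rintro S hS rfl
    exact ⟨_, hI _ _ _ hS, upd _ _ _, (Runs.pop S (ρ r)).mono (by omega)⟩
  | seq _ _ ih₁ ih₂ =>
    intro S hS hs
    obtain ⟨S₁, hS₁, hs₁, h₁⟩ := ih₁ S hS hs
    obtain ⟨S₂, hS₂, hs₂, h₂⟩ := ih₂ S₁ hS₁ hs₁
    exact ⟨S₂, hS₂, hs₂, (h₁.seq h₂).mono (by rw [mul_add])⟩
  | branch_nil hr _ ih =>
    rintro S hS rfl
    obtain ⟨S₁, hS₁, hs₁, h₁⟩ := ih S hS rfl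
    exact ⟨S₁, hS₁, hs₁, (Runs.branch_nil (r := ρ _) hr h₁).mono (by rw [mul_add]; omega)⟩
  | branch_false hr _ ih =>
    rintro S hS rfl
    obtain ⟨S₁, hS₁, hs₁, h₁⟩ := ih S hS rfl
    exact ⟨S₁, hS₁, hs₁, (Runs.branch_false (r := ρ _) hr h₁).mono (by rw [mul_add]; omega)⟩
  | branch_true hr _ ih =>
    rintro S hS rfl
    obtain ⟨S₁, hS₁, hs₁, h₁⟩ := ih S hS rfl
    exact ⟨S₁, hS₁, hs₁, (Runs.branch_true (r := ρ _) hr h₁).mono (by rw [mul_add]; omega)⟩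
  | loop_done hr =>
    rintro S hS rfl
    exact ⟨S, hS, rfl, (Runs.loop_done (r := ρ _) hr).mono (by omega)⟩
  | loop_step hr _ _ ih₁ ih₂ =>
    rintro S hS rfl
    obtain ⟨S₁, hS₁, hs₁, h₁⟩ := ih₁ S hS rfl
    obtain ⟨S₂, hS₂, hs₂, h₂⟩ := ih₂ S₁ hS₁ hs₁
    exact ⟨S₂, hS₂, hs₂,
      (Runs.loop_step (r := ρ _) hr h₁ h₂).mono (by rw [mul_add, mul_add]; omega)⟩
  | query s q a =>
    rintro S hS rfl
    exact ⟨_, hI _ _ _ hS, upd _ _ _, (hsub q a S hS).mono (by omega)⟩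

/-- Without an oracle, a register grows by at most one bit per step. -/
theorem Exec.length_le {p : Prog} {s s' : Store} {t : ℕ} (h : Exec noOracle p s s' t) (r : ℕ) :
    (s' r).length ≤ (s r).length + t := by
  induction h with
  | skip s => omega
  | push s r' b => by_cases h : r = r' <;> simp [h]
  | pop s r' => by_cases h : r = r' <;> simp [h]; omega
  | query s q a => by_cases h : r = a <;> simp [h, noOracle]
  | _ => omega

/-! ### Determinism and dependence on the oracle -/

theorem Exec.deterministic {O : List Bool → List Bool} {p : Prog} {s s₁ s₂ : Store} {t₁ t₂ : ℕ}
    (h₁ : Exec O p s s₁ t₁) (h₂ : Exec O p s s₂ t₂) : s₁ = s₂ := by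
  induction h₁ generalizing s₂ t₂ with
  | skip | push | pop | query => cases h₂; rfl
  | seq _ _ ih₁ ih₂ =>
    cases h₂ with
    | seq h h' => obtain rfl := ih₁ h; exact ih₂ h'
  | branch_nil hr _ ih | branch_false hr _ ih | branch_true hr _ ih =>
    cases h₂ with
    | branch_nil hr' h => first | exact ih h | simp [hr] at hr'
    | branch_false hr' h => first | exact ih h | simp [hr] at hr'
    | branch_true hr' h => first | exact ih h | simp [hr] at hr'
  | loop_done hr =>
    cases h₂ with
    | loop_done => rfl
    | loop_step hr' => exact absurd hr hr'
  | loop_step hr _ _ ih₁ ih₂ =>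
    cases h₂ with
    | loop_done hr' => exact absurd hr' hr
    | loop_step _ h h' => obtain rfl := ih₁ h; exact ih₂ h'

open Classical in
/-- A computation of `t` steps depends on at most `t` values of the oracle. -/
theorem Exec.exists_queries {O : List Bool → List Bool} {p : Prog} {s s' : Store} {t : ℕ}
    (h : Exec O p s s' t) :
    ∃ Q : Finset (List Bool), Q.card ≤ t ∧
      ∀ O' : List Bool → List Bool, (∀ x ∈ Q, O' x = O x) → Exec O' p s s' t := by
  induction h with
  | skip s => exact ⟨∅, by simp, fun _ _ => .skip s⟩
  | push s r b => exact ⟨∅, by simp, fun _ _ => .push s r b⟩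
  | pop s r => exact ⟨∅, by simp, fun _ _ => .pop s r⟩
  | seq _ _ ih₁ ih₂ =>
    obtain ⟨Q₁, hc₁, hQ₁⟩ := ih₁
    obtain ⟨Q₂, hc₂, hQ₂⟩ := ih₂
    exact ⟨Q₁ ∪ Q₂, (Finset.card_union_le _ _).trans (by omega), fun O' h =>
      (hQ₁ O' fun x hx => h x (by simp [hx])).seq (hQ₂ O' fun x hx => h x (by simp [hx]))⟩
  | branch_nil hr _ ih =>
    obtain ⟨Q, hc, hQ⟩ := ih
    exact ⟨Q, by omega, fun O' h => .branch_nil hr (hQ O' h)⟩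
  | branch_false hr _ ih =>
    obtain ⟨Q, hc, hQ⟩ := ih
    exact ⟨Q, by omega, fun O' h => .branch_false hr (hQ O' h)⟩
  | branch_true hr _ ih =>
    obtain ⟨Q, hc, hQ⟩ := ih
    exact ⟨Q, by omega, fun O' h => .branch_true hr (hQ O' h)⟩
  | loop_done hr => exact ⟨∅, by simp, fun _ _ => .loop_done hr⟩
  | loop_step hr _ _ ih₁ ih₂ =>
    obtain ⟨Q₁, hc₁, hQ₁⟩ := ih₁
    obtain ⟨Q₂, hc₂, hQ₂⟩ := ih₂
    exact ⟨Q₁ ∪ Q₂, (Finset.card_union_le _ _).trans (by omega), fun O' h =>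
      .loop_step hr (hQ₁ O' fun x hx => h x (by simp [hx]))
        (hQ₂ O' fun x hx => h x (by simp [hx]))⟩
  | query s q a =>
    refine ⟨{s q}, by simp, fun O' h => ?_⟩
    rw [← h (s q) (by simp)]
    exact .query s q a

/-! ### Stores with named work registers

The registers below `9` are work registers: `0` holds `1^n` and `1` the adjacency matrix of a graph
with `n` vertices, row by row; `2` and `3` hold copies of the characteristic vector of the set in
question, `4` and `5` hold what has been removed from other registers until it is put back, `6` is a
unary and `7` a binary counter, and `8` is used in the final comparison. All other registers are
described by a store of their own.
-/

/-- The store whose first registers are listed in `L`, and which agrees with `s` elsewhere. -/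
def withRegs (L : List (List Bool)) (s : Store) : Store := fun r => L.getD r (s r)

theorem withRegs_ge {L : List (List Bool)} {r : ℕ} (h : L.length ≤ r) (s : Store) :
    withRegs L s r = s r := by
  simp [withRegs, List.getElem?_eq_none h]

theorem update_withRegs_lt {L : List (List Bool)} {r : ℕ} (h : r < L.length) (s : Store)
    (v : List Bool) : Function.update (withRegs L s) r v = withRegs (L.set r v) s := by
  funext x
  by_cases hx : x = r
  · subst hx
    simp [withRegs, h]
  · simp [withRegs, hx, List.getElem?_set_ne (Ne.symm hx)]

theorem update_withRegs_ge {L : List (List Bool)} {r : ℕ} (h : L.length ≤ r) (s : Store)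
    (v : List Bool) :
    Function.update (withRegs L s) r v = withRegs L (Function.update s r v) := by
  funext x
  by_cases hx : x = r
  · subst hx
    simp [withRegs, List.getElem?_eq_none h]
  · simp [withRegs, hx]

namespace Runs

variable {L : List (List Bool)} {s : Store} {r r' : ℕ}

theorem push_lt (b : Bool) (h : r < L.length) :
    Runs (.push r b) (withRegs L s) (withRegs (L.set r (b :: withRegs L s r)) s) 1 :=
  (Runs.push _ r b).congr (update_withRegs_lt h _ _) le_rfl

theorem push_ge (b : Bool) (h : L.length ≤ r) :
    Runs (.push r b) (withRegs L s) (withRegs L (Function.update s r (b :: s r))) 1 :=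
  (Runs.push _ r b).congr (by rw [update_withRegs_ge h, withRegs_ge h]) le_rfl

theorem pop_lt (h : r < L.length) :
    Runs (.pop r) (withRegs L s) (withRegs (L.set r (withRegs L s r).tail) s) 1 :=
  (Runs.pop _ r).congr (update_withRegs_lt h _ _) le_rfl

theorem pop_ge (h : L.length ≤ r) :
    Runs (.pop r) (withRegs L s) (withRegs L (Function.update s r (s r).tail)) 1 :=
  (Runs.pop _ r).congr (by rw [update_withRegs_ge h, withRegs_ge h]) le_rfl

theorem clear_lt (q : ℕ) (h : r < L.length) :
    Runs (.query q r) (withRegs L s) (withRegs (L.set r []) s) 1 :=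
  (Runs.clear _ q r).congr (update_withRegs_lt h _ _) le_rfl

theorem clear_ge (q : ℕ) (h : L.length ≤ r) :
    Runs (.query q r) (withRegs L s) (withRegs L (Function.update s r [])) 1 :=
  (Runs.clear _ q r).congr (update_withRegs_ge h _ _) le_rfl

theorem withTop_lt {bit : Bool → Prog} {S' : Store} {T : ℕ} {b : Bool} {l : List Bool}
    (h : r < L.length) (hr : withRegs L s r = b :: l)
    (h' : Runs (bit b) (withRegs (L.set r l) s) S' T) :
    Runs (withTop r bit) (withRegs L s) S' (T + 2) :=
  runs_withTop hr (by rwa [update_withRegs_lt h])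

theorem moveAll_lt_lt (hne : r ≠ r') (h : r < L.length) (h' : r' < L.length) :
    Runs (moveAll r r') (withRegs L s)
      (withRegs ((L.set r []).set r' ((withRegs L s r).reverse ++ withRegs L s r')) s)
      (4 * (withRegs L s r).length + 1) :=
  (runs_moveAll hne _).congr
    (by rw [update_withRegs_lt h, update_withRegs_lt (by simpa using h')]) le_rfl

theorem moveAll_lt_ge (hne : r ≠ r') (h : r < L.length) (h' : L.length ≤ r') :
    Runs (moveAll r r') (withRegs L s)
      (withRegs (L.set r []) (Function.update s r' ((withRegs L s r).reverse ++ s r')))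
      (4 * (withRegs L s r).length + 1) :=
  (runs_moveAll hne _).congr
    (by rw [update_withRegs_lt h, update_withRegs_ge (by simpa using h'), withRegs_ge h']) le_rfl

theorem moveAll_ge_lt (hne : r ≠ r') (h : L.length ≤ r) (h' : r' < L.length) :
    Runs (moveAll r r') (withRegs L s)
      (withRegs (L.set r' ((s r).reverse ++ withRegs L s r')) (Function.update s r []))
      (4 * (s r).length + 1) :=
  (runs_moveAll hne _).congr
    (by rw [update_withRegs_ge h, update_withRegs_lt (by simpa using h'), withRegs_ge h])
    (by rw [withRegs_ge h])

end Runs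

/-! ### Counting edges -/

/-- The first `m` bits of a string, which is padded with `false` if it is too short. -/
def padTake : ℕ → List Bool → List Bool
  | 0, _ => []
  | m + 1, x => x.headD false :: padTake m x.tail

@[simp] theorem length_padTake (m : ℕ) (x : List Bool) : (padTake m x).length = m := by
  induction m generalizing x with
  | zero => rfl
  | succ m ih => simp [padTake, ih]

theorem padTake_eq (m : ℕ) (x : List Bool) :
    padTake m x = (List.finRange m).map fun i : Fin m => x.getD i false := by
  induction m generalizing x with
  | zero => rfl
  | succ m ih =>
    rw [padTake, ih, List.finRange_succ]
    cases x <;> simp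

/-- With `1^m` in register `0`, read the first `m` bits of register `q` into register `7`, in
reverse order. What is removed from the registers `0` and `q` is kept in the registers `4`
and `5`. -/
def readProg (q : ℕ) : Prog :=
  .loop 0 (.pop 0 ⨾ .push 4 true ⨾ .branch q (.push 7 false)
    (.pop q ⨾ .push 7 false ⨾ .push 5 false) (.pop q ⨾ .push 7 true ⨾ .push 5 true))

theorem runs_readProg {q : ℕ} (hq : 9 ≤ q) (A X Y U W : List Bool) (m : ℕ)
    (Z R B : List Bool) (s : Store) :
    Runs (readProg q) (withRegs [List.replicate m true, A, X, Y, Z, R, U, B, W] s)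
      (withRegs [[], A, X, Y, List.replicate m true ++ Z, ((s q).take m).reverse ++ R, U,
        (padTake m (s q)).reverse ++ B, W] (Function.update s q ((s q).drop m)))
      (7 * m + 1) := by
  induction m generalizing Z R B s with
  | zero => exact (Runs.loop_done rfl).congr (by simp [padTake]) (by omega)
  | succ m ih =>
    have hrep : List.replicate m true ++ true :: Z = List.replicate (m + 1) true ++ Z := by
      rw [List.replicate_succ']; simp
    have h1 : Runs (.pop 0) (withRegs [List.replicate (m + 1) true, A, X, Y, Z, R, U, B, W] s)
        (withRegs [List.replicate m true, A, X, Y, Z, R, U, B, W] s) 1 := Runs.pop_lt (by simp)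
    have h2 : Runs (.push 4 true) (withRegs [List.replicate m true, A, X, Y, Z, R, U, B, W] s)
        (withRegs [List.replicate m true, A, X, Y, true :: Z, R, U, B, W] s) 1 :=
      Runs.push_lt true (by simp)
    have hget : ∀ N Z, withRegs [N, A, X, Y, Z, R, U, B, W] s q = s q := fun N Z =>
      withRegs_ge (by simpa using hq) s
    have h3 : Runs (.branch q (.push 7 false)
        (.pop q ⨾ .push 7 false ⨾ .push 5 false) (.pop q ⨾ .push 7 true ⨾ .push 5 true))
        (withRegs [List.replicate m true, A, X, Y, true :: Z, R, U, B, W] s)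
        (withRegs [List.replicate m true, A, X, Y, true :: Z, (s q).take 1 ++ R, U,
          (s q).headD false :: B, W] (Function.update s q (s q).tail)) 4 := by
      have hget : withRegs [List.replicate m true, A, X, Y, true :: Z, R, U, B, W] s q = s q :=
        withRegs_ge (by simpa using hq) s
      cases hsq : s q with
      | nil =>
        refine (Runs.branch_nil (hget.trans hsq) (Runs.push_lt (r := 7) false (by simp))).congr ?_
          (by omega)
        rw [List.tail_nil, ← hsq, Function.update_eq_self, hsq]
        rfl
      | cons b l =>
        have h3 := fun b => (Runs.pop_ge (L := [List.replicate m true, A, X, Y, true :: Z, R, U, B,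
            W]) (s := s) (r := q) (by simpa using hq)).seq
          ((Runs.push_lt (r := 7) b (by simp)).seq (Runs.push_lt (r := 5) b (by simp)))
        rw [hsq] at h3
        cases b
        · exact (Runs.branch_false (hget.trans hsq) (h3 false)).congr rfl (by omega)
        · exact (Runs.branch_true (hget.trans hsq) (h3 true)).congr rfl (by omega)
    refine (Runs.loop_step (List.cons_ne_nil _ _) (h1.seq (h2.seq h3)) (ih (true :: Z)
      ((s q).take 1 ++ R) ((s q).headD false :: B)
      (Function.update s q (s q).tail))).congr ?_ (by omega)
    rw [Function.update_self, Function.update_idem, hrep]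
    cases hsq : s q <;> simp [padTake]

/-- Move register `7` to the registers `2` and `3`, reversing it. -/
def spreadProg : Prog := .loop 7 (withTop 7 fun b => .push 2 b ⨾ .push 3 b)

theorem runs_spreadProg (N A Z R U W : List Bool) (B X Y : List Bool) (s : Store) :
    Runs spreadProg (withRegs [N, A, X, Y, Z, R, U, B, W] s)
      (withRegs [N, A, B.reverse ++ X, B.reverse ++ Y, Z, R, U, [], W] s)
      (5 * B.length + 1) := by
  induction B generalizing X Y with
  | nil => exact Runs.loop_done rfl
  | cons b l ih =>
    refine (Runs.loop_step (List.cons_ne_nil _ _) (Runs.withTop_lt (b := b) (l := l) (by simp) rfl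
      ((Runs.push_lt b (by simp)).seq (Runs.push_lt (r := 3) b (by simp))))
      (ih (b :: X) (b :: Y))).congr (by simp) ?_
    simp
    omega

/-- The number of positions at which both lists have `true`, or zero if `y = false`. -/
def dot (y : Bool) : List Bool → List Bool → ℕ
  | x :: X, a :: A => (if y && x && a then 1 else 0) + dot y X A
  | _, _ => 0

/-- Traverse register `2` and, in parallel, register `1`, and increase the unary number in register
`6` by the number of common `true`s, or not at all if `y = false`. The bits read are kept in the
registers `4` and `5`. -/
def rowProg (y : Bool) : Prog :=
  .loop 2 (withTop 2 fun x => .push 4 x ⨾ withTop 1 fun a => .push 5 a ⨾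
    if y && x && a then .push 6 true else .skip)

theorem runs_rowProg (y : Bool) (N Y C W : List Bool) (s : Store) (X A₀ : List Bool)
    (hA : A₀.length = X.length) (A Z B U : List Bool) :
    Runs (rowProg y) (withRegs [N, A₀ ++ A, X, Y, Z, B, U, C, W] s)
      (withRegs [N, A, [], Y, X.reverse ++ Z, A₀.reverse ++ B,
        List.replicate (dot y X A₀) true ++ U, C, W] s)
      (8 * X.length + 1) := by
  induction X generalizing A₀ Z B U with
  | nil =>
    obtain rfl : A₀ = [] := by simpa using hA
    exact Runs.loop_done rfl
  | cons x X ih =>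
    obtain ⟨a, A₀, rfl⟩ := List.exists_cons_of_length_eq_add_one hA
    have hlast : Runs (if y && x && a then .push 6 true else .skip)
        (withRegs [N, A₀ ++ A, X, Y, x :: Z, a :: B, U, C, W] s)
        (withRegs [N, A₀ ++ A, X, Y, x :: Z, a :: B,
          List.replicate (if y && x && a then 1 else 0) true ++ U, C, W] s) 1 := by
      split
      · exact Runs.push_lt true (by simp)
      · exact Runs.skip _
    refine (Runs.loop_step (List.cons_ne_nil _ _) (Runs.withTop_lt (b := x) (l := X) (by simp) rfl
      ((Runs.push_lt x (by simp)).seq (Runs.withTop_lt (b := a) (l := A₀ ++ A) (by simp) rfl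
        ((Runs.push_lt (r := 5) a (by simp)).seq hlast))))
      (ih A₀ (by simpa using hA) (x :: Z) (a :: B) _)).congr ?_ ?_
    · rw [← List.append_assoc, List.replicate_append_replicate, dot]
      simp [add_comm]
    · simp
      omega

/-- The sum of `dot y X row` over the bits `y` of `Y` and the corresponding rows. -/
def bilinear (X : List Bool) : List Bool → List (List Bool) → ℕ
  | y :: Y, row :: rows => dot y X row + bilinear X Y rows
  | _, _ => 0

/-- Evaluate the quadratic form of the matrix in register `1` at the vectors in the registers `3`
and `2`. -/
def matrixProg : Prog :=
  .loop 3 (withTop 3 fun y => rowProg y ⨾ moveAll 4 2)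

theorem runs_matrixProg (N X C W : List Bool) (s : Store) (Y : List Bool) (rows : List (List Bool))
    (hlen : rows.length = Y.length) (hrows : ∀ row ∈ rows, row.length = X.length)
    (A B U : List Bool) :
    Runs matrixProg (withRegs [N, rows.flatten ++ A, X, Y, [], B, U, C, W] s)
      (withRegs [N, A, X, [], [], rows.flatten.reverse ++ B,
        List.replicate (bilinear X Y rows) true ++ U, C, W] s)
      ((12 * X.length + 5) * Y.length + 1) := by
  induction Y generalizing rows B U with
  | nil =>
    obtain rfl : rows = [] := by simpa using hlen
    exact (Runs.loop_done rfl).mono (by omega)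
  | cons y Y ih =>
    obtain ⟨row, rows, rfl⟩ := List.exists_cons_of_length_eq_add_one hlen
    have h1 := runs_rowProg y N Y C W s X row (hrows _ (by simp)) (rows.flatten ++ A) [] B U
    have h2 := h1.seq (Runs.moveAll_lt_lt (r := 4) (r' := 2) (by simp) (by simp) (by simp))
    rw [← List.append_assoc, ← List.flatten_cons] at h2
    have h3 : Runs (rowProg y ⨾ moveAll 4 2)
        (withRegs [N, (row :: rows).flatten ++ A, X, Y, [], B, U, C, W] s)
        (withRegs [N, rows.flatten ++ A, X, Y, [], row.reverse ++ B,
          List.replicate (dot y X row) true ++ U, C, W] s) (12 * X.length + 2) := by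
      refine h2.congr ?_ ?_
      · simp [withRegs]
      · simp [withRegs]
        omega
    refine (Runs.loop_step (List.cons_ne_nil _ _) (Runs.withTop_lt (b := y) (l := Y) (by simp) rfl
      h3) (ih rows (by simpa using hlen) (fun r hr => hrows r (by simp [hr])) _ _)).congr ?_ ?_
    · rw [← List.append_assoc, ← List.append_assoc, List.replicate_append_replicate, bilinear]
      simp [add_comm]
    · simp [mul_add]
      omega

/-- With `1^n` and an `n × n` matrix in the registers `0` and `1`, write in unary to register `6`
the value of the quadratic form of the matrix at the vector in register `q`. -/
def countProg (q : ℕ) : Prog :=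
  readProg q ⨾ moveAll 5 q ⨾ moveAll 4 0 ⨾ spreadProg ⨾ matrixProg ⨾ moveAll 5 1 ⨾ .query 2 2

/-- A bound on the running time of `countProg` for `n × n` matrices. -/
def countTime (n : ℕ) : ℕ := 16 * n * n + 40 * n + 40

theorem runs_countProg {q : ℕ} (hq : 9 ≤ q) (n : ℕ) (rows : List (List Bool))
    (hlen : rows.length = n) (hrows : ∀ row ∈ rows, row.length = n) (W : List Bool) (s : Store) :
    Runs (countProg q)
      (withRegs [List.replicate n true, rows.flatten, [], [], [], [], [], [], W] s)
      (withRegs [List.replicate n true, rows.flatten, [], [], [], [],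
        List.replicate (bilinear (padTake n (s q)) (padTake n (s q)) rows) true, [], W] s)
      (countTime n) := by
  set N := List.replicate n true with hN
  set X := padTake n (s q) with hX
  have hXl : X.length = n := length_padTake n _
  have hflat : rows.flatten.length = n * n := by
    rw [List.length_flatten, List.map_congr_left hrows]
    simp [hlen]
  have h1 : Runs (readProg q) (withRegs [N, rows.flatten, [], [], [], [], [], [], W] s)
      (withRegs [[], rows.flatten, [], [], N, ((s q).take n).reverse, [], X.reverse, W]
        (Function.update s q ((s q).drop n))) (7 * n + 1) := by
    simpa using runs_readProg hq rows.flatten [] [] [] W n [] [] [] s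
  have h2 : Runs (moveAll 5 q)
      (withRegs [[], rows.flatten, [], [], N, ((s q).take n).reverse, [], X.reverse, W]
        (Function.update s q ((s q).drop n)))
      (withRegs [[], rows.flatten, [], [], N, [], [], X.reverse, W] s) (4 * n + 1) := by
    refine (Runs.moveAll_lt_ge (by omega) (by simp) (by simpa using hq)).congr ?_ ?_
    · rw [Function.update_self, Function.update_idem]
      simp [withRegs]
    · simp [withRegs]
  have h3 : Runs (moveAll 4 0) (withRegs [[], rows.flatten, [], [], N, [], [], X.reverse, W] s)
      (withRegs [N, rows.flatten, [], [], [], [], [], X.reverse, W] s) (4 * n + 1) :=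
    (Runs.moveAll_lt_lt (by omega) (by simp) (by simp)).congr
      (by simp [withRegs, hN]) (by simp [withRegs, hN])
  have h4 : Runs spreadProg (withRegs [N, rows.flatten, [], [], [], [], [], X.reverse, W] s)
      (withRegs [N, rows.flatten, X, X, [], [], [], [], W] s) (5 * n + 1) := by
    simpa [hXl] using runs_spreadProg N rows.flatten [] [] [] W X.reverse [] [] s
  have h5 : Runs matrixProg (withRegs [N, rows.flatten, X, X, [], [], [], [], W] s)
      (withRegs [N, [], X, [], [], rows.flatten.reverse,
        List.replicate (bilinear X X rows) true, [], W] s) ((12 * n + 5) * n + 1) := by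
    simpa [hXl] using runs_matrixProg N X [] W s X rows (by rw [hlen, hXl])
      (fun r hr => by rw [hrows r hr, hXl]) [] [] []
  have h6 : Runs (moveAll 5 1) (withRegs [N, [], X, [], [], rows.flatten.reverse,
        List.replicate (bilinear X X rows) true, [], W] s)
      (withRegs [N, rows.flatten, X, [], [], [],
        List.replicate (bilinear X X rows) true, [], W] s) (4 * (n * n) + 1) :=
    (Runs.moveAll_lt_lt (by omega) (by simp) (by simp)).congr
      (by simp [withRegs]) (by simp [withRegs, -List.length_flatten, hflat])
  refine (h1.seq (h2.seq (h3.seq (h4.seq (h5.seq (h6.seq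
    (Runs.clear_lt 2 (by simp)))))))).congr rfl ?_
  rw [countTime]
  ring_nf
  omega

/-! ### Conversion to binary -/

/-- The successor on binary numbers with the least significant bit first. -/
def incBits : List Bool → List Bool
  | [] => [true]
  | false :: l => true :: l
  | true :: l => false :: incBits l

theorem incBits_bits (n : ℕ) : incBits n.bits = (n + 1).bits := by
  induction n using Nat.binaryRec' with
  | zero => rfl
  | bit b n h ih =>
    rw [Nat.bits_append_bit n b h]
    cases b
    · simp [incBits, ← Nat.bit1_bits]
    · have : Nat.bit true n + 1 = 2 * (n + 1) := by simp; ring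
      rw [incBits, ih, this, Nat.bit0_bits _ (by omega)]

theorem tail_bits_two_mul (n : ℕ) : (2 * n).bits.tail = n.bits := by
  rcases Nat.eq_zero_or_pos n with rfl | h
  · simp
  · rw [Nat.bit0_bits _ h.ne']
    rfl

theorem length_bits_le (n : ℕ) : n.bits.length ≤ n := by
  rw [Nat.size_eq_bits_len]
  exact Nat.size_le.2 Nat.lt_two_pow_self

/-- Increase the binary number in register `7`. The trailing ones are put, as zeros, into
register `4` until the first zero has been found. -/
def incProg : Prog :=
  .push 3 true ⨾ .loop 3 (.branch 7 (.pop 3 ⨾ .push 7 true)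
    (.pop 3 ⨾ .pop 7 ⨾ .push 7 true) (.pop 7 ⨾ .push 4 false)) ⨾ moveAll 4 7

theorem runs_incProg (N A X R U W : List Bool) (s : Store) (C : List Bool) :
    Runs incProg (withRegs [N, A, X, [], [], R, U, C, W] s)
      (withRegs [N, A, X, [], [], R, U, incBits C, W] s) (8 * C.length + 8) := by
  have key : ∀ C Z : List Bool, ∃ Z' C' : List Bool, Z'.reverse ++ C' = Z.reverse ++ incBits C ∧
      Z'.length ≤ Z.length + C.length ∧
      Runs (.loop 3 (.branch 7 (.pop 3 ⨾ .push 7 true)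
        (.pop 3 ⨾ .pop 7 ⨾ .push 7 true) (.pop 7 ⨾ .push 4 false)))
        (withRegs [N, A, X, [true], Z, R, U, C, W] s)
        (withRegs [N, A, X, [], Z', R, U, C', W] s) (4 * C.length + 6) := by
    intro C
    induction C with
    | nil =>
      intro Z
      refine ⟨Z, [true], by simp [incBits], by simp, ?_⟩
      exact (Runs.loop_step (List.cons_ne_nil _ _) (Runs.branch_nil rfl
        ((Runs.pop_lt (by simp)).seq (Runs.push_lt (r := 7) true (by simp))))
        (Runs.loop_done rfl)).congr rfl (by simp)
    | cons b C ih =>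
      intro Z
      cases b
      · refine ⟨Z, true :: C, by simp [incBits], by simp, ?_⟩
        exact (Runs.loop_step (List.cons_ne_nil _ _) (Runs.branch_false rfl
          ((Runs.pop_lt (by simp)).seq ((Runs.pop_lt (r := 7) (by simp)).seq
            (Runs.push_lt (r := 7) true (by simp)))))
          (Runs.loop_done rfl)).congr rfl (by simp)
      · obtain ⟨Z', C', h, hl, hrun⟩ := ih (false :: Z)
        refine ⟨Z', C', by simp [h, incBits], by simp at hl ⊢; omega, ?_⟩
        exact (Runs.loop_step (List.cons_ne_nil _ _) (Runs.branch_true rfl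
          ((Runs.pop_lt (r := 7) (by simp)).seq
            (Runs.push_lt (r := 4) false (by simp)))) hrun).congr rfl (by simp; omega)
  obtain ⟨Z', C', h, hl, hrun⟩ := key C []
  refine ((Runs.push_lt (r := 3) true (by simp)).seq (hrun.seq
    (Runs.moveAll_lt_lt (r := 4) (r' := 7) (by simp) (by simp) (by simp)))).congr ?_ ?_
  · simp [withRegs] at h ⊢
    rw [h]
  · simp [withRegs] at hl ⊢
    omega

/-- Convert the unary number in register `6` to binary, in register `7`. -/
def binaryProg : Prog := .loop 6 (.pop 6 ⨾ incProg)

theorem runs_binaryProg (N A X R W : List Bool) (s : Store) (u c : ℕ) :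
    Runs binaryProg (withRegs [N, A, X, [], [], R, List.replicate u true, c.bits, W] s)
      (withRegs [N, A, X, [], [], R, [], (u + c).bits, W] s) ((8 * (u + c) + 10) * u + 1) := by
  induction u generalizing c with
  | zero => exact (Runs.loop_done rfl).congr (by simp) (by omega)
  | succ u ih =>
    have h1 := (Runs.pop_lt (r := 6)
      (L := [N, A, X, [], [], R, List.replicate (u + 1) true, c.bits, W]) (by simp)).seq
      (runs_incProg N A X R (List.replicate u true) W s c.bits)
    rw [incBits_bits] at h1
    have := length_bits_le c
    refine (Runs.loop_step (List.cons_ne_nil _ _) h1 (ih (c + 1))).congr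
      (by rw [add_right_comm, add_assoc]) ?_
    ring_nf
    omega

/-- Answer a query for half of the value that `countProg` computes. -/
def answerProg (q a : ℕ) : Prog :=
  countProg q ⨾ binaryProg ⨾ .pop 7 ⨾ .query a a ⨾ moveAll 7 4 ⨾ moveAll 4 a

/-- A bound on the running time of `answerProg`. -/
def answerTime (n : ℕ) : ℕ := countTime n + (8 * (n * n) + 10) * (n * n) + 8 * (n * n) + 10

theorem runs_answerProg {q a : ℕ} (hq : 9 ≤ q) (ha : 9 ≤ a) (n : ℕ) (rows : List (List Bool))
    (hlen : rows.length = n) (hrows : ∀ row ∈ rows, row.length = n) (W : List Bool) (s : Store)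
    {e : ℕ} (he : bilinear (padTake n (s q)) (padTake n (s q)) rows = 2 * e)
    (hen : 2 * e ≤ n * n) :
    Runs (answerProg q a)
      (withRegs [List.replicate n true, rows.flatten, [], [], [], [], [], [], W] s)
      (withRegs [List.replicate n true, rows.flatten, [], [], [], [], [], [], W]
        (Function.update s a e.bits))
      (answerTime n) := by
  set N := List.replicate n true with hN
  have h1 := runs_countProg hq n rows hlen hrows W s
  rw [he] at h1
  have h2 : Runs binaryProg
      (withRegs [N, rows.flatten, [], [], [], [], List.replicate (2 * e) true, [], W] s)
      (withRegs [N, rows.flatten, [], [], [], [], [], (2 * e).bits, W] s)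
      ((8 * (n * n) + 10) * (n * n) + 1) := by
    refine (runs_binaryProg N rows.flatten [] [] W s (2 * e) 0).congr rfl ?_
    rw [add_zero]
    gcongr
  have h3 : Runs (.pop 7)
      (withRegs [N, rows.flatten, [], [], [], [], [], (2 * e).bits, W] s)
      (withRegs [N, rows.flatten, [], [], [], [], [], e.bits, W] s) 1 :=
    (Runs.pop_lt (by simp)).congr (by rw [← tail_bits_two_mul e]; rfl) le_rfl
  have h4 : Runs (.query a a) (withRegs [N, rows.flatten, [], [], [], [], [], e.bits, W] s)
      (withRegs [N, rows.flatten, [], [], [], [], [], e.bits, W] (Function.update s a [])) 1 :=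
    Runs.clear_ge a (by simpa using ha)
  have h5 := h4.seq ((Runs.moveAll_lt_lt (r := 7) (r' := 4) (by simp) (by simp) (by simp)).seq
    (Runs.moveAll_lt_ge (r := 4) (r' := a) (by omega) (by simp) (by simpa using ha)))
  refine (h1.seq (h2.seq (h3.seq h5))).congr ?_ ?_
  · simp [withRegs]
  · have := length_bits_le e
    simp [withRegs, answerTime]
    omega

/-! ### Edges inside a set of vertices -/

/-- The number of edges of `G` with both ends in `S`. -/
noncomputable def edgesWithin {n : ℕ} (G : SimpleGraph (Fin n)) (S : Finset (Fin n)) : ℕ :=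
  {e ∈ G.edgeSet | ∀ v ∈ e, v ∈ S}.ncard

theorem edgesWithin_mono {n : ℕ} (G : SimpleGraph (Fin n)) {S T : Finset (Fin n)} (h : S ⊆ T) :
    edgesWithin G S ≤ edgesWithin G T :=
  Set.ncard_le_ncard (fun _ he => ⟨he.1, fun v hv => h (he.2 v hv)⟩) (Set.toFinite _)

open Classical in
theorem two_mul_edgesWithin {n : ℕ} (G : SimpleGraph (Fin n)) (S : Finset (Fin n)) :
    2 * edgesWithin G S = ∑ i ∈ S, {j ∈ S | G.Adj i j}.card := by
  let H : SimpleGraph (Fin n) :=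
    { Adj := fun i j => G.Adj i j ∧ i ∈ S ∧ j ∈ S
      symm := ⟨fun i j h => ⟨h.1.symm, h.2.2, h.2.1⟩⟩
      loopless := ⟨fun i h => G.loopless.irrefl i h.1⟩ }
  have hedges : (H.edgeFinset : Set (Sym2 (Fin n))) = {e ∈ G.edgeSet | ∀ v ∈ e, v ∈ S} := by
    ext e
    induction e using Sym2.ind with
    | h i j => simp [H]
  rw [edgesWithin, ← hedges, Set.ncard_coe_finset, ← H.sum_degrees_eq_twice_card_edges,
    ← Finset.sum_subset (Finset.subset_univ S)]
  · refine Finset.sum_congr rfl fun i hi => ?_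
    rw [← H.card_neighborFinset_eq_degree]
    congr 1
    ext j
    simp [H, hi, and_comm]
  · intro i _ hi
    rw [← H.card_neighborFinset_eq_degree, Finset.card_eq_zero]
    ext j
    simp [H, hi]

theorem two_mul_edgesWithin_le {n : ℕ} (G : SimpleGraph (Fin n)) (S : Finset (Fin n)) :
    2 * edgesWithin G S ≤ n * n := by
  classical
  rw [two_mul_edgesWithin]
  calc ∑ i ∈ S, {j ∈ S | G.Adj i j}.card ≤ ∑ _i ∈ S, n :=
        Finset.sum_le_sum fun i _ => card_finset_fin_le _
    _ = S.card * n := by simp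
    _ ≤ n * n := Nat.mul_le_mul_right _ (card_finset_fin_le S)

open Classical in
theorem two_mul_edgesWithin_add_interedges {n d : ℕ} {G : SimpleGraph (Fin n)}
    (hG : G.IsRegularOfDegree d) (S : Finset (Fin n)) :
    2 * edgesWithin G S + (G.interedges S Sᶜ).card = d * S.card := by
  have hinter : (G.interedges S Sᶜ).card = ∑ i ∈ S, {j ∈ Sᶜ | G.Adj i j}.card := by
    rw [SimpleGraph.interedges, Rel.interedges, Finset.card_filter, Finset.sum_product]
    simp only [Finset.card_filter]
  rw [two_mul_edgesWithin, hinter, ← Finset.sum_add_distrib, mul_comm, ← smul_eq_mul,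
    ← Finset.sum_const]
  refine Finset.sum_congr rfl fun i _ => ?_
  rw [← hG i, ← G.card_neighborFinset_eq_degree, ← Finset.card_union_of_disjoint]
  · congr 1
    ext j
    simp only [Finset.mem_union, Finset.mem_filter, Finset.mem_compl,
      SimpleGraph.mem_neighborFinset]
    tauto
  · exact Finset.disjoint_filter_filter disjoint_compl_right

open Classical in
theorem two_mul_edgesWithin_univ {n d : ℕ} {G : SimpleGraph (Fin n)}
    (hG : G.IsRegularOfDegree d) : 2 * edgesWithin G Finset.univ = d * n := by
  have h := two_mul_edgesWithin_add_interedges hG Finset.univ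
  simpa [SimpleGraph.interedges, Rel.interedges] using h

open Classical in
/-- In a regular graph, the expansion of `S` determines the number of edges inside `S`. -/
theorem two_mul_edgesWithin_eq {n d : ℕ} {G : SimpleGraph (Fin n)}
    (hG : G.IsRegularOfDegree d) (hd : 0 < d) {S : Finset (Fin n)} (hS : 0 < S.card) :
    (2 * edgesWithin G S : ℝ) = (1 - edgeExpansion G S) * (d * S.card) := by
  have h : (2 * edgesWithin G S + (G.interedges S Sᶜ).card : ℝ) = d * S.card := by
    exact_mod_cast two_mul_edgesWithin_add_interedges hG S
  have hpos : (0 : ℝ) < d * S.card := by positivity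
  have hexp : edgeExpansion G S * (d * S.card) = ((G.interedges S Sᶜ).card : ℝ) := by
    have hsum : ∑ v ∈ S, (G.degree v : ℝ) = d * S.card := by
      rw [Finset.sum_congr rfl fun v _ => by rw [hG v]]
      simp [mul_comm]
    rw [edgeExpansion, hsum, div_mul_cancel₀ _ hpos.ne']
  rw [sub_mul, one_mul, hexp]
  linarith

/-! ### The gap for densest subgraphs -/

theorem exists_edgesWithin_ge_of_smallSetExpansion_le {n : ℕ} {G : SimpleGraph (Fin n)} {η δ : ℝ}
    (hG : IsSSEInstance G δ) (hδ : 0 < δ) (hδ' : δ ≤ 1) (h : smallSetExpansion G δ ≤ η) {k : ℕ}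
    (hk : (k : ℝ) = δ * n) :
    ∃ T : Finset (Fin n), T.card = k ∧
      (1 - η) * (δ * (2 * edgesWithin G Finset.univ)) ≤ 2 * edgesWithin G T := by
  obtain ⟨hn, ⟨d, hd, hreg⟩, -⟩ := hG
  have hn' : (0 : ℝ) < n := by exact_mod_cast hn
  have hk0 : 0 < k := by
    have : (0 : ℝ) < k := by rw [hk]; positivity
    exact_mod_cast this
  have hkn : k ≤ n := by
    have : (k : ℝ) ≤ n := by rw [hk]; nlinarith
    exact_mod_cast this
  obtain ⟨T₀, -, hT₀⟩ := Finset.exists_subset_card_eq (s := (Finset.univ : Finset (Fin n)))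
    (by simpa using hkn)
  have : Nonempty {S : Finset (Fin n) // (S.card : ℝ) = δ * n} := ⟨⟨T₀, by rw [hT₀, hk]⟩⟩
  obtain ⟨⟨T, hT⟩, hmin⟩ := exists_eq_ciInf_of_finite
    (f := fun S : {S : Finset (Fin n) // (S.card : ℝ) = δ * n} => edgeExpansion G S.1)
  have hTk : T.card = k := by
    have : (T.card : ℝ) = k := by rw [hT, hk]
    exact_mod_cast this
  have hle : edgeExpansion G T ≤ η := le_of_eq_of_le hmin h
  refine ⟨T, hTk, ?_⟩
  have huniv : (2 * edgesWithin G Finset.univ : ℝ) = d * n := by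
    exact_mod_cast two_mul_edgesWithin_univ hreg
  rw [huniv, two_mul_edgesWithin_eq hreg hd (hTk ▸ hk0), hT]
  have : δ * (d * n : ℝ) = d * (δ * n) := by ring
  rw [this]
  gcongr

theorem edgesWithin_le_of_le_smallSetExpansion {n : ℕ} {G : SimpleGraph (Fin n)} {η δ : ℝ}
    (hG : IsSSEInstance G δ) (hδ : 0 < δ) (hδ' : δ ≤ 1) (h : 1 - η ≤ smallSetExpansion G δ)
    {k : ℕ} (hk : (k : ℝ) = δ * n) {S : Finset (Fin n)} (hS : S.card ≤ k) :
    (2 * edgesWithin G S : ℝ) ≤ η * (δ * (2 * edgesWithin G Finset.univ)) := by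
  obtain ⟨hn, ⟨d, hd, hreg⟩, -⟩ := hG
  have hn' : (0 : ℝ) < n := by exact_mod_cast hn
  have hk0 : 0 < k := by
    have : (0 : ℝ) < k := by rw [hk]; positivity
    exact_mod_cast this
  have hkn : k ≤ n := by
    have : (k : ℝ) ≤ n := by rw [hk]; nlinarith
    exact_mod_cast this
  obtain ⟨T, hST, -, hTk⟩ := Finset.exists_subsuperset_card_eq (Finset.subset_univ S) hS
    (by simpa using hkn)
  have hT : (T.card : ℝ) = δ * n := by rw [hTk, hk]
  have hexp : 1 - η ≤ edgeExpansion G T :=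
    h.trans (ciInf_le (Set.finite_range
      (fun S : {S : Finset (Fin n) // (S.card : ℝ) = δ * n} => edgeExpansion G S.1)).bddBelow
      ⟨T, hT⟩)
  have hmono : (edgesWithin G S : ℝ) ≤ edgesWithin G T := by
    exact_mod_cast edgesWithin_mono G hST
  have huniv : (2 * edgesWithin G Finset.univ : ℝ) = d * n := by
    exact_mod_cast two_mul_edgesWithin_univ hreg
  calc (2 * edgesWithin G S : ℝ) ≤ 2 * edgesWithin G T := by linarith
    _ = (1 - edgeExpansion G T) * (d * T.card) :=
        two_mul_edgesWithin_eq hreg hd (hTk ▸ hk0)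
    _ ≤ η * (d * T.card) := by gcongr; linarith
    _ = η * (δ * (2 * edgesWithin G Finset.univ)) := by rw [hT, huniv]; ring

/-! ### The graph encoding and the counting program -/

open Classical in
/-- The rows of the adjacency matrix. -/
noncomputable def adjRows {n : ℕ} (G : SimpleGraph (Fin n)) : List (List Bool) :=
  (List.finRange n).map fun i => (List.finRange n).map fun j => decide (G.Adj i j)

theorem encodeGraph_eq {n : ℕ} (G : SimpleGraph (Fin n)) :
    encodeGraph G = List.replicate n true ++ false :: (adjRows G).flatten := by
  rw [encodeGraph, adjRows, List.flatMap_def]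

theorem length_adjRows {n : ℕ} (G : SimpleGraph (Fin n)) : (adjRows G).length = n := by
  simp [adjRows]

theorem length_of_mem_adjRows {n : ℕ} (G : SimpleGraph (Fin n)) :
    ∀ row ∈ adjRows G, row.length = n := by
  simp [adjRows]

theorem length_flatten_adjRows {n : ℕ} (G : SimpleGraph (Fin n)) :
    (adjRows G).flatten.length = n * n := by
  rw [List.length_flatten, List.map_congr_left (length_of_mem_adjRows G)]
  simp [length_adjRows]

theorem dot_map {ι : Type*} (y : Bool) (f g : ι → Bool) (l : List ι) :
    dot y (l.map f) (l.map g) = (l.map fun i => if y && f i && g i then 1 else 0).sum := by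
  induction l with
  | nil => rfl
  | cons i l ih => simp [dot, ih]

theorem bilinear_map {ι : Type*} (X : List Bool) (f : ι → Bool) (g : ι → List Bool) (l : List ι) :
    bilinear X (l.map f) (l.map g) = (l.map fun i => dot (f i) X (g i)).sum := by
  induction l with
  | nil => rfl
  | cons i l ih => simp [bilinear, ih]

theorem bilinear_adjRows {n : ℕ} (G : SimpleGraph (Fin n)) (x : List Bool) :
    bilinear (padTake n x) (padTake n x) (adjRows G) = 2 * edgesWithin G (decodeSet n x) := by
  classical
  rw [two_mul_edgesWithin, padTake_eq, adjRows, bilinear_map]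
  simp only [dot_map, ← Fin.sum_univ_def, Finset.card_filter, decodeSet, Finset.sum_filter]
  have key : ∀ f : Fin n → Bool,
      (∑ i, ∑ j, if (f i && f j && decide (G.Adj i j)) = true then 1 else 0) =
        ∑ i, if f i = true then ∑ j, if f j = true then if G.Adj i j then 1 else 0 else 0
          else 0 := by
    intro f
    refine Finset.sum_congr rfl fun i _ => ?_
    cases f i
    · simp
    · simp only [Bool.true_and, if_true]
      refine Finset.sum_congr rfl fun j _ => ?_
      cases f j <;> simp
  exact key fun i => x.getD i false

/-! ### Deciding a language by a reduction and an approximation algorithm -/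

/-- Unpack the code of a graph in register `9`. The number of its vertices is written in unary to
the registers `0`, `9` and `10`, and `a / b` times this number to register `12`; the
adjacency matrix is written to register `1`. -/
def parseProg (a b : ℕ) : Prog :=
  .loop 9 (.branch 9 .skip (.pop 9 ⨾ moveAll 9 5)
    (.pop 9 ⨾ .push 0 true ⨾ .push 6 true ⨾ .push 7 true ⨾ .push 10 true)) ⨾
  moveAll 5 1 ⨾ moveAll 7 9 ⨾ scaleProg 6 12 a b

theorem runs_parse_loop (A : List Bool) (n : ℕ) (N U B : List Bool) (s : Store)
    (hs : s 9 = List.replicate n true ++ false :: A) :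
    Runs (.loop 9 (.branch 9 .skip (.pop 9 ⨾ moveAll 9 5)
        (.pop 9 ⨾ .push 0 true ⨾ .push 6 true ⨾ .push 7 true ⨾ .push 10 true)))
      (withRegs [N, [], [], [], [], [], U, B, []] s)
      (withRegs [List.replicate n true ++ N, [], [], [], [], A.reverse,
        List.replicate n true ++ U, List.replicate n true ++ B, []]
        (Function.update (Function.update s 9 []) 10 (List.replicate n true ++ s 10)))
      (7 * n + 4 * A.length + 5) := by
  have hrep : ∀ (n : ℕ) (l : List Bool),
      List.replicate n true ++ true :: l = List.replicate (n + 1) true ++ l := fun n l => by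
    rw [List.replicate_succ']; simp
  induction n generalizing N U B s with
  | zero =>
    have h1 := (Runs.pop_ge (L := [N, [], [], [], [], [], U, B, []]) (s := s) (r := 9)
      (by simp)).seq (Runs.moveAll_ge_lt (r := 9) (r' := 5) (by simp) (by simp) (by simp))
    rw [hs] at h1
    refine (Runs.loop_step (r := 9) (S := withRegs [N, [], [], [], [], [], U, B, []] s) ?_
      (Runs.branch_false (l := A) ?_ h1) (Runs.loop_done ?_)).congr ?_ ?_
    · change s 9 ≠ []
      simp [hs]
    · exact hs
    · rw [withRegs_ge (by simp), Function.update_self]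
    · have h10 : Function.update (Function.update s 9 []) 10 (s 10) = Function.update s 9 [] :=
        Function.update_eq_self_iff.2 (by simp)
      simp [withRegs, h10]
    · simp
      omega
  | succ n ih =>
    have h1 := (Runs.pop_ge (L := [N, [], [], [], [], [], U, B, []]) (s := s) (r := 9)
      (by simp)).seq ((Runs.push_lt (r := 0) true (by simp)).seq
        ((Runs.push_lt (r := 6) true (by simp)).seq ((Runs.push_lt (r := 7) true (by simp)).seq
          (Runs.push_ge (r := 10) true (by simp)))))
    refine (Runs.loop_step (r := 9) (S := withRegs [N, [], [], [], [], [], U, B, []] s) ?_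
      (Runs.branch_true (l := List.replicate n true ++ false :: A) ?_ h1)
      (ih (true :: N) (true :: U) (true :: B) _ ?_)).congr ?_ ?_
    · change s 9 ≠ []
      simp [hs]
    · exact hs
    · simp [hs]
    · rw [hrep, hrep, hrep]
      congr 1
      funext x
      by_cases h9 : x = 9
      · simp [h9]
      · by_cases h10 : x = 10
        · simp [h10, hrep]
        · simp [h9, h10]
    · omega

/-- A bound on the running time of `parseProg` for graphs with `n` vertices. -/
def parseTime (a b n : ℕ) : ℕ := 8 * (n * n) + (11 + (2 * a + 2 * b + 3)) * n + 10

theorem runs_parseProg {n : ℕ} (G : SimpleGraph (Fin n)) (a : ℕ) {b j : ℕ} (hb : 0 < b)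
    (hn : n = b * j) (s : Store) (hs : s 9 = encodeGraph G) (hs' : ∀ r, s (2 * r + 10) = []) :
    ∃ s' : Store, Runs (parseProg a b) (withRegs [[], [], [], [], [], [], [], [], []] s)
        (withRegs [List.replicate n true, (adjRows G).flatten, [], [], [], [], [], [], []] s')
        (parseTime a b n) ∧
      s' 9 = List.replicate n true ∧
      (s' ∘ fun r => 2 * r + 10)
        = initStore [List.replicate n true, List.replicate (a * j) true] := by
  set N := List.replicate n true with hN
  set A := (adjRows G).flatten with hA
  have hAl : A.length = n * n := length_flatten_adjRows G
  have h10 : s 10 = [] := hs' 0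
  have h12 : s 12 = [] := hs' 1
  have h1 := runs_parse_loop A n [] [] [] s (hs.trans (encodeGraph_eq G))
  simp only [List.append_nil, ← hN, h10] at h1
  set s₁ := Function.update (Function.update s 9 []) 10 N with hs₁
  have h2 : Runs (moveAll 5 1) (withRegs [N, [], [], [], [], A.reverse, N, N, []] s₁)
      (withRegs [N, A, [], [], [], [], N, N, []] s₁) (4 * (n * n) + 1) :=
    (Runs.moveAll_lt_lt (by simp) (by simp) (by simp)).congr
      (by simp [withRegs]) (by simp [withRegs, -List.length_flatten, hAl])
  have h3 : Runs (moveAll 7 9) (withRegs [N, A, [], [], [], [], N, N, []] s₁)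
      (withRegs [N, A, [], [], [], [], N, [], []] (Function.update s₁ 9 N)) (4 * n + 1) :=
    (Runs.moveAll_lt_ge (by simp) (by simp) (by simp)).congr
      (by simp [withRegs, hs₁, hN]) (by simp [withRegs, hN])
  have h4 : Runs (scaleProg 6 12 a b)
      (withRegs [N, A, [], [], [], [], N, [], []] (Function.update s₁ 9 N))
      (withRegs [N, A, [], [], [], [], [], [], []]
        (Function.update (Function.update s₁ 9 N) 12 (List.replicate (a * j) true)))
      ((2 * a + 2 * b + 3) * j + 1) := by
    refine (runs_scaleProg (by simp) a hb j _ (by rw [← hn]; rfl)).congr ?_ le_rfl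
    rw [update_withRegs_lt (by simp), update_withRegs_ge (by simp), withRegs_ge (by simp)]
    simp [hs₁, h12]
  refine ⟨_, (h1.seq (h2.seq (h3.seq h4))).mono ?_, by simp, ?_⟩
  · have hj : j ≤ n := by rw [hn]; exact Nat.le_mul_of_pos_left j hb
    have := Nat.mul_le_mul_left (2 * a + 2 * b + 3) hj
    rw [parseTime, hAl, add_mul 11]
    omega
  · funext r
    match r with
    | 0 => simp [hs₁, initStore]
    | 1 => simp [initStore]
    | r + 2 =>
      have h : s (2 * (r + 2) + 10) = [] := hs' (r + 2)
      simp [hs₁, initStore, h, show 2 * (r + 2) + 10 ≠ 12 by omega]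

/-- Write `[true]` to register `0` if `a` times the number of edges of the graph is less than `m`
times the number of edges inside the set in register `10`, and `[]` otherwise. Register `9` has to
contain the set of all vertices. -/
def compareProg (a m : ℕ) : Prog :=
  countProg 10 ⨾ scaleProg 6 8 m 1 ⨾ countProg 9 ⨾ subtractProg 6 8 a ⨾ .query 0 0 ⨾
    .branch 8 .skip (.push 0 true) (.push 0 true)

/-- A bound on the running time of `compareProg` for graphs with `n` vertices. -/
def compareTime (a m n : ℕ) : ℕ := 2 * countTime n + (2 * a + 2 * m + 8) * (n * n) + 10

theorem decodeSet_replicate_true (n : ℕ) :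
    decodeSet n (List.replicate n true) = Finset.univ := by
  ext i
  simp [decodeSet]

theorem runs_compareProg {n : ℕ} (G : SimpleGraph (Fin n)) (a m : ℕ) (s : Store)
    (hs : s 9 = List.replicate n true) :
    ∃ S', Runs (compareProg a m)
        (withRegs [List.replicate n true, (adjRows G).flatten, [], [], [], [], [], [], []] s)
        S' (compareTime a m n) ∧
      S' 0 = if a * (2 * edgesWithin G Finset.univ) < m * (2 * edgesWithin G (decodeSet n (s 10)))
        then [true] else [] := by
  set N := List.replicate n true with hN
  set A := (adjRows G).flatten with hA
  set u := 2 * edgesWithin G (decodeSet n (s 10)) with hu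
  set v := 2 * edgesWithin G Finset.univ with hv
  have hun : u ≤ n * n := two_mul_edgesWithin_le G _
  have hvn : v ≤ n * n := two_mul_edgesWithin_le G _
  have h1 := runs_countProg (q := 10) (by simp) n (adjRows G) (length_adjRows G)
    (length_of_mem_adjRows G) [] s
  rw [bilinear_adjRows, ← hu] at h1
  have h2 : Runs (scaleProg 6 8 m 1)
      (withRegs [N, A, [], [], [], [], List.replicate u true, [], []] s)
      (withRegs [N, A, [], [], [], [], [], [], List.replicate (m * u) true] s)
      ((2 * m + 5) * u + 1) := by
    refine (runs_scaleProg (by simp) m one_pos u _ (by rw [one_mul]; rfl)).congr ?_ le_rfl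
    rw [update_withRegs_lt (by simp), update_withRegs_lt (by simp)]
    simp [withRegs]
  have h3 := runs_countProg (q := 9) (by simp) n (adjRows G) (length_adjRows G)
    (length_of_mem_adjRows G) (List.replicate (m * u) true) s
  rw [bilinear_adjRows, hs, decodeSet_replicate_true, ← hv] at h3
  have h4 : Runs (subtractProg 6 8 a)
      (withRegs [N, A, [], [], [], [], List.replicate v true, [], List.replicate (m * u) true] s)
      (withRegs [N, A, [], [], [], [], [], [], List.replicate (m * u - a * v) true] s)
      ((2 * a + 3) * v + 1) := by
    refine (runs_subtractProg (by simp) a v _ rfl).congr ?_ le_rfl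
    rw [update_withRegs_lt (by simp), update_withRegs_lt (by simp)]
    simp [withRegs]
  have h5 : Runs (.query 0 0)
      (withRegs [N, A, [], [], [], [], [], [], List.replicate (m * u - a * v) true] s)
      (withRegs [[], A, [], [], [], [], [], [], List.replicate (m * u - a * v) true] s) 1 :=
    Runs.clear_lt 0 (by simp)
  have h6 : Runs (.branch 8 .skip (.push 0 true) (.push 0 true))
      (withRegs [[], A, [], [], [], [], [], [], List.replicate (m * u - a * v) true] s)
      (withRegs [if a * v < m * u then [true] else [], A, [], [], [], [], [], [],
        List.replicate (m * u - a * v) true] s) 2 := by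
    split_ifs with h
    · obtain ⟨w, hw⟩ : ∃ w, m * u - a * v = w + 1 := ⟨m * u - a * v - 1, by omega⟩
      rw [hw]
      exact Runs.branch_true (l := List.replicate w true) rfl (Runs.push_lt true (by simp))
    · rw [Nat.sub_eq_zero_of_le (not_lt.1 h)]
      exact Runs.branch_nil rfl (Runs.skip _)
  refine ⟨_, (h1.seq (h2.seq (h3.seq (h4.seq (h5.seq h6))))).mono ?_, rfl⟩
  have h7 := Nat.mul_le_mul_left (2 * m + 5) hun
  have h8 := Nat.mul_le_mul_left (2 * a + 3) hvn
  have h9 : (2 * a + 2 * m + 8) * (n * n) = (2 * m + 5) * (n * n) + (2 * a + 3) * (n * n) := by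
    ring
  rw [compareTime, h9]
  omega

theorem eval_mono (q : Polynomial ℕ) : Monotone fun n => q.eval n := by
  intro m n h
  simp only [Polynomial.eval_eq_sum_range]
  gcongr

theorem valueBits_edgesWithin_le {n : ℕ} (G : SimpleGraph (Fin n)) :
    valueBits (edgesWithin G) ≤ n * n :=
  Finset.sup_le fun S _ => (length_bits_le _).trans (by have := two_mul_edgesWithin_le G S; omega)

/-- The program that applies the reduction `pF`, runs the approximation algorithm `p` on the
resulting graph, and compares the number of edges that it finds with the total number of edges.
The reduction uses the odd registers from `9` on, the algorithm the even ones from `10` on. -/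
def decisionProg (pF p : Prog) (a b m : ℕ) : Prog :=
  moveAll 0 1 ⨾ moveAll 1 9 ⨾
  translate (fun r => 2 * r + 9) (fun q a => .query (2 * q + 9) (2 * a + 9)) pF ⨾
  parseProg a b ⨾
  translate (fun r => 2 * r + 10) (fun q a => answerProg (2 * q + 10) (2 * a + 10)) p ⨾
  compareProg a m

theorem runs_load (x : List Bool) :
    Runs (moveAll 0 1 ⨾ moveAll 1 9) (initStore [x])
      (withRegs [[], [], [], [], [], [], [], [], []] (Function.update (fun _ => []) 9 x))
      (8 * x.length + 2) := by
  have h0 : initStore [x] = withRegs [x, [], [], [], [], [], [], [], []] (fun _ => []) := by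
    funext r
    match r with
    | 0 | 1 | 2 | 3 | 4 | 5 | 6 | 7 | 8 => rfl
    | r + 9 => simp [withRegs, initStore]
  rw [h0]
  refine ((Runs.moveAll_lt_lt (r := 0) (r' := 1) (by simp) (by simp) (by simp)).seq
    (Runs.moveAll_lt_ge (r := 1) (r' := 9) (by simp) (by simp) (by simp))).congr ?_ ?_
  · simp [withRegs]
  · simp [withRegs]
    omega

theorem runs_reduction {pF : Prog} {x y : List Bool} {T : ℕ} (h : OutputsWithin pF [x] y T) :
    ∃ s : Store, Runs
        (translate (fun r => 2 * r + 9) (fun q a => .query (2 * q + 9) (2 * a + 9)) pF)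
        (withRegs [[], [], [], [], [], [], [], [], []] (Function.update (fun _ => []) 9 x))
        (withRegs [[], [], [], [], [], [], [], [], []] s) T ∧
      s 9 = y ∧ ∀ r, s (2 * r + 10) = [] := by
  obtain ⟨s', t, hexec, ht, hy⟩ := h
  obtain ⟨S', ⟨s, rfl, hs⟩, hS', hrun⟩ := runs_translate (ρ := fun r => 2 * r + 9)
    (fun r r' h => by simpa using h)
    (sub := fun q a => .query (2 * q + 9) (2 * a + 9)) (D := 1) le_rfl
    (I := fun S => ∃ s, S = withRegs [[], [], [], [], [], [], [], [], []] s ∧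
      ∀ r, s (2 * r + 10) = [])
    (by
      rintro _ r v ⟨s, rfl, hs⟩
      refine ⟨_, update_withRegs_ge (by simp) s v, fun r' => ?_⟩
      rw [Function.update_of_ne (by omega), hs])
    (fun q a S _ => Runs.clear S _ _) hexec
    (withRegs [[], [], [], [], [], [], [], [], []] (Function.update (fun _ => []) 9 x))
    ⟨_, rfl, fun r => by simp⟩
    (by
      funext r
      rw [Function.comp_apply, withRegs_ge (by simp)]
      cases r <;> simp [initStore])
  refine ⟨s, hrun.mono (by omega), ?_, hs⟩
  rw [← hy, ← hS']
  rfl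

theorem runs_algorithm {p : Prog} {n k t : ℕ} (G : SimpleGraph (Fin n)) {s s' : Store}
    (h : Exec (valueOracle (edgesWithin G)) p
      (initStore [List.replicate n true, List.replicate k true]) s' t)
    (hs : s 9 = List.replicate n true)
    (hs' : (s ∘ fun r => 2 * r + 10)
      = initStore [List.replicate n true, List.replicate k true]) :
    ∃ s₁ : Store, Runs
        (translate (fun r => 2 * r + 10) (fun q a => answerProg (2 * q + 10) (2 * a + 10)) p)
        (withRegs [List.replicate n true, (adjRows G).flatten, [], [], [], [], [], [], []] s)
        (withRegs [List.replicate n true, (adjRows G).flatten, [], [], [], [], [], [], []] s₁)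
        (answerTime n * t) ∧
      s₁ 9 = List.replicate n true ∧ s₁ 10 = s' 0 := by
  set L := [List.replicate n true, (adjRows G).flatten, [], [], [], [], [], [], []] with hL
  obtain ⟨S', ⟨s₁, rfl, hs₁⟩, hS', hrun⟩ := runs_translate (ρ := fun r => 2 * r + 10)
    (fun r r' h => by simpa using h)
    (sub := fun q a => answerProg (2 * q + 10) (2 * a + 10)) (D := answerTime n)
    (by rw [answerTime]; omega)
    (I := fun S => ∃ s, S = withRegs L s ∧ s 9 = List.replicate n true)
    (by
      rintro _ r v ⟨s, rfl, hs⟩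
      refine ⟨_, update_withRegs_ge (by simp [hL]) s v, ?_⟩
      rw [Function.update_of_ne (by omega), hs])
    (by
      rintro q a _ ⟨s, rfl, -⟩
      refine (runs_answerProg (by omega) (by omega) n (adjRows G) (length_adjRows G)
        (length_of_mem_adjRows G) [] s (bilinear_adjRows G _)
        (two_mul_edgesWithin_le G _)).congr ?_ le_rfl
      rw [update_withRegs_ge (by simp [hL]), withRegs_ge (by simp [hL])]
      rfl) h (withRegs L s) ⟨s, rfl, hs⟩
    (by
      rw [← hs']
      funext r
      exact withRegs_ge (by simp [hL]) s)
  refine ⟨s₁, hrun, hs₁, ?_⟩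
  rw [← hS']
  rfl

/-- The combined program decides by comparing edge numbers, in polynomial time, whatever set the
approximation algorithm returns. -/
theorem exists_outputsWithin_decisionProg {pF p : Prog} {qF q : Polynomial ℕ}
    {F : List Bool → List Bool} (hF : ∀ x, OutputsWithin pF [x] (F x) (qF.eval x.length))
    (a : ℕ) {b : ℕ} (hb : 0 < b) (m : ℕ) :
    ∃ Q : Polynomial ℕ, ∀ (x : List Bool) (n j : ℕ) (G : SimpleGraph (Fin n)) (s : Store) (t : ℕ),
      F x = encodeGraph G → n = b * j →
      Exec (valueOracle (edgesWithin G)) p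
        (initStore [List.replicate n true, List.replicate (a * j) true]) s t →
      t ≤ q.eval (n + valueBits (edgesWithin G)) →
      OutputsWithin (decisionProg pF p a b m) [x]
        (if a * (2 * edgesWithin G Finset.univ) < m * (2 * edgesWithin G (decodeSet n (s 0)))
          then [true] else []) (Q.eval x.length) := by
  let time : ℕ → ℕ := fun y => parseTime a b y + answerTime y * q.eval y + compareTime a m y
  have htime : Monotone time := by
    intro y y' h
    have := eval_mono q h
    simp only [time, parseTime, answerTime, compareTime, countTime]
    gcongr
  obtain ⟨R, hR⟩ : ∃ R : Polynomial ℕ, ∀ y, R.eval y = time y := by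
    let Y : Polynomial ℕ := .X
    let cnt : Polynomial ℕ := 16 * Y * Y + 40 * Y + 40
    refine ⟨(8 * (Y * Y) + (11 + (2 * .C a + 2 * .C b + 3)) * Y + 10) +
      (cnt + (8 * (Y * Y) + 10) * (Y * Y) + 8 * (Y * Y) + 10) * q +
      (2 * cnt + (2 * .C a + 2 * .C m + 8) * (Y * Y) + 10), fun y => ?_⟩
    simp [time, Y, cnt, parseTime, answerTime, compareTime, countTime]
  refine ⟨8 * .X + 2 + qF + R.comp (.X + qF), fun x n j G s t hx hn hexec ht => ?_⟩
  have hsize : n + n * n ≤ x.length + qF.eval x.length := by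
    obtain ⟨s', t', h, ht', hs'⟩ := hF x
    have hlen := h.length_le 0
    have h0 : initStore [x] 0 = x := rfl
    rw [hs', hx, encodeGraph_eq, List.length_append, List.length_replicate, List.length_cons,
      length_flatten_adjRows, h0] at hlen
    omega
  obtain ⟨s₁, h₁, hs₁, hs₁'⟩ := runs_reduction (hF x)
  obtain ⟨s₂, h₂, hs₂, hs₂'⟩ := runs_parseProg G a hb hn s₁ (hs₁.trans hx) hs₁'
  obtain ⟨s₃, h₃, hs₃, hs₃'⟩ := runs_algorithm G hexec hs₂ hs₂'
  obtain ⟨S, h₄, hS⟩ := runs_compareProg G a m s₃ hs₃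
  rw [hs₃'] at hS
  obtain ⟨t₀, ht₀, e₀⟩ := runs_load x
  obtain ⟨t₁, ht₁, e₁⟩ := h₁.seq (h₂.seq (h₃.seq h₄))
  cases e₀ with
  | seq e e' =>
    refine ⟨S, _, e.seq (e'.seq e₁), ?_, hS⟩
    have htq : t ≤ q.eval (x.length + qF.eval x.length) :=
      ht.trans (eval_mono q (by have := valueBits_edgesWithin_le G; omega))
    have hn' : n ≤ x.length + qF.eval x.length := by omega
    have hle : parseTime a b n + answerTime n * t + compareTime a m n
        ≤ time (x.length + qF.eval x.length) := by
      have h1 : parseTime a b n ≤ parseTime a b (x.length + qF.eval x.length) := by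
        simp only [parseTime]
        gcongr
      have h2 : answerTime n ≤ answerTime (x.length + qF.eval x.length) := by
        simp only [answerTime, countTime]
        gcongr
      have h3 : compareTime a m n ≤ compareTime a m (x.length + qF.eval x.length) := by
        simp only [compareTime, countTime]
        gcongr
      exact add_le_add (add_le_add h1 (Nat.mul_le_mul h2 htq)) h3
    simp only [Polynomial.eval_add, Polynomial.eval_mul, Polynomial.eval_comp, Polynomial.eval_X,
      Polynomial.eval_ofNat, hR]
    omega

/-! ### The classes P and NP -/

theorem classP_subset_classNP : classP ⊆ classNP := by
  rintro L ⟨F, ⟨p, q, hp⟩, hF⟩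
  -- The verifier empties the register of the certificate before it runs `p`.
  refine ⟨.query 1 1 ⨾ p, q + 1, fun x _ => F x, fun x w _ => ?_, fun x => ?_⟩
  · obtain ⟨s, t, h, ht, hs⟩ := hp x
    have hstore : Function.update (initStore [x, w]) 1 [] = initStore [x] := by
      funext r
      match r with
      | 0 | 1 => rfl
      | r + 2 => simp [initStore]
    have hq := Exec.query (O := noOracle) (initStore [x, w]) 1 1
    rw [show noOracle (initStore [x, w] 1) = [] from rfl, hstore] at hq
    exact ⟨s, _, hq.seq h, by simp; omega, hs⟩
  · rw [hF]
    exact ⟨fun h => ⟨[], by simp, h⟩, fun ⟨_, _, h⟩ => h⟩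

theorem edgesWithin_univ_pos {n : ℕ} {G : SimpleGraph (Fin n)} {δ : ℝ} (hG : IsSSEInstance G δ) :
    0 < edgesWithin G Finset.univ := by
  obtain ⟨hn, ⟨d, hd, hreg⟩, -⟩ := hG
  have := two_mul_edgesWithin_univ hreg
  have : 0 < d * n := by positivity
  omega

/-- If the small-set expansion problem with parameter `1 / M` is NP-hard, where
`M > 1 + 1 / c`, then a `c`-approximation algorithm for the number of induced edges decides every
language in NP. -/
theorem classNP_subset_classP {c δ : ℝ} (hc : 0 < c) {M : ℕ} (hM : 1 + 1 / c < M) (hδ : 0 < δ)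
    (hδ' : δ < 1) (hhard : NPHard (gapSSE (1 / M) δ))
    (happrox : HasPolyTimeApprox inducedEdgeCounts c) : classNP ⊆ classP := by
  classical
  intro L hL
  obtain ⟨F, ⟨pF, qF, hpF⟩, hF⟩ := hhard L hL
  obtain ⟨p, q, hp⟩ := happrox
  have hinst : ∀ x, ∃ (n : ℕ) (G : SimpleGraph (Fin n)), F x = encodeGraph G ∧
      IsSSEInstance G δ ∧ (x ∈ L → smallSetExpansion G δ ≤ 1 / M) ∧
      (x ∉ L → 1 - 1 / M ≤ smallSetExpansion G δ) := by
    intro x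
    by_cases hx : x ∈ L
    · obtain ⟨n, G, h1, h2, h3⟩ := (hF x).1 hx
      exact ⟨n, G, h1, h2, fun _ => h3, fun h => absurd hx h⟩
    · obtain ⟨n, G, h1, h2, h3⟩ := (hF x).2 hx
      exact ⟨n, G, h1, h2, fun h => absurd h hx, fun _ => h3⟩
  -- Since instances exist, `δ` is rational.
  obtain ⟨a, b, hb, hab, hδab⟩ : ∃ a b : ℕ, 0 < b ∧ a.Coprime b ∧ δ * b = a := by
    obtain ⟨n, G, -, ⟨hn, -, k, hk⟩, -⟩ := hinst []
    obtain ⟨a, b, hab, ha, hb⟩ := Nat.exists_coprime k n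
    have hg : 0 < k.gcd n := Nat.gcd_pos_of_pos_right k hn
    refine ⟨a, b, Nat.pos_of_ne_zero fun h => by simp [h] at hb; omega, hab, ?_⟩
    have hg' : (0 : ℝ) < k.gcd n := by exact_mod_cast hg
    have ha' : (k : ℝ) = a * k.gcd n := by exact_mod_cast ha
    have hb' : (n : ℝ) = b * k.gcd n := by exact_mod_cast hb
    have : δ * b * k.gcd n = a * k.gcd n := by rw [← ha', hk, hb']; ring
    exact mul_right_cancel₀ hg'.ne' this
  obtain ⟨Q, hQ⟩ := exists_outputsWithin_decisionProg (p := p) (q := q) hpF a hb (M * b)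
  have hM1 : 1 < c * (M - 1) := by
    have h : 1 / c < (M : ℝ) - 1 := by linarith
    rwa [div_lt_iff₀ hc, mul_comm] at h
  have hM0 : (0 : ℝ) < M := by
    have : 0 < 1 / c := by positivity
    linarith
  refine ⟨fun x => if x ∈ L then [true] else [], ⟨decisionProg pF p a b (M * b), Q, fun x => ?_⟩,
    fun x => by by_cases hx : x ∈ L <;> simp [hx]⟩
  obtain ⟨n, G, hx, hG, hyes, hno⟩ := hinst x
  obtain ⟨hn, -, k, hk⟩ := id hG
  have hb0 : (0 : ℝ) < b := by exact_mod_cast hb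
  obtain ⟨j, rfl⟩ : b ∣ n := by
    have h : a * n = b * k := by
      have : (a * n : ℝ) = b * k := by rw [hk, ← hδab]; ring
      exact_mod_cast this
    exact (hab.symm.dvd_of_dvd_mul_left ⟨k, h⟩)
  have hkj : k = a * j := by
    have : (k : ℝ) = a * j := by rw [hk, ← hδab]; push_cast; ring
    exact_mod_cast this
  have hkn : a * j ≤ b * j := by
    have : (a : ℝ) ≤ b := by rw [← hδab]; nlinarith
    exact Nat.mul_le_mul_right j (by exact_mod_cast this)
  obtain ⟨s, t, hexec, ht, hcard, hmax⟩ :=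
    hp (b * j) (a * j) (edgesWithin G) hkn ⟨G, fun _ => rfl⟩
  have hout := hQ x (b * j) j G s t hx rfl hexec ht
  convert hout using 1
  set S := decodeSet (b * j) (s 0)
  rw [hkj] at hk
  have hE : (0 : ℝ) < δ * (2 * edgesWithin G Finset.univ) := by
    have : (0 : ℝ) < edgesWithin G Finset.univ := by exact_mod_cast edgesWithin_univ_pos hG
    positivity
  -- Acceptance means that `S` contains more than `δ / M` of all edges.
  have haccept : a * (2 * edgesWithin G Finset.univ) < M * b * (2 * edgesWithin G S) ↔
      δ * (2 * edgesWithin G Finset.univ : ℝ) < M * (2 * edgesWithin G S) := by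
    rw [← mul_lt_mul_iff_right₀ hb0, ← Nat.cast_lt (α := ℝ)]
    push_cast
    rw [← hδab]
    constructor <;> intro h <;> linarith
  refine if_congr (Iff.trans ?_ haccept.symm) rfl rfl
  constructor
  · intro hxL
    obtain ⟨T, hT, hTe⟩ := exists_edgesWithin_ge_of_smallSetExpansion_le hG hδ hδ'.le (hyes hxL) hk
    have hS := hmax T hT.le
    have h1 : c * ((1 - 1 / M) * (δ * (2 * edgesWithin G Finset.univ))) ≤ 2 * edgesWithin G S := by
      have := mul_le_mul_of_nonneg_left hTe hc.le
      linarith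
    calc δ * (2 * edgesWithin G Finset.univ : ℝ)
        < c * (M - 1) * (δ * (2 * edgesWithin G Finset.univ)) := lt_mul_of_one_lt_left hE hM1
      _ = M * (c * ((1 - 1 / M) * (δ * (2 * edgesWithin G Finset.univ)))) := by
        field_simp
      _ ≤ M * (2 * edgesWithin G S) := mul_le_mul_of_nonneg_left h1 hM0.le
  · intro h
    by_contra hxL
    have h1 := edgesWithin_le_of_le_smallSetExpansion hG hδ hδ'.le (hno hxL) hk hcard
    have h2 := mul_le_mul_of_nonneg_left h1 hM0.le
    have h3 : M * (1 / M * (δ * (2 * edgesWithin G Finset.univ : ℝ)))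
        = δ * (2 * edgesWithin G Finset.univ) := by field_simp
    linarith

/-! ### The query lower bound for monotone functions -/

/-- A polynomial is eventually smaller than the central binomial coefficient. -/
theorem exists_eval_lt_centralBinom (q : Polynomial ℕ) : ∃ k, q.eval k < k.centralBinom := by
  have hlittle : ∀ r : Polynomial ℕ,
      (fun k : ℕ => ((r.eval k : ℕ) : ℝ)) =o[Filter.atTop] fun k => (4 : ℝ) ^ k := by
    intro r
    simp only [Polynomial.eval_eq_sum_range]
    push_cast
    refine Asymptotics.IsLittleO.fun_sum fun i _ => ?_
    exact (isLittleO_pow_const_const_pow_of_one_lt i (by norm_num : (1 : ℝ) < 4)).const_mul_left _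
  have hev := (hlittle (2 * .X * q)).bound (c := 1 / 2) (by norm_num)
  obtain ⟨k, hk, hk0⟩ := (hev.and (Filter.eventually_gt_atTop 0)).exists
  refine ⟨k, ?_⟩
  have h1 : 2 * k * q.eval k < 4 ^ k := by
    have : (2 * k * q.eval k : ℝ) < 4 ^ k := by
      have h4 : (0 : ℝ) < 4 ^ k := by positivity
      simp at hk
      linarith
    exact_mod_cast this
  have h2 := Nat.four_pow_le_two_mul_self_mul_centralBinom k hk0
  exact Nat.lt_of_mul_lt_mul_left (h1.trans_le h2)

/-- The set function that is one on the sets with more than `k` elements and on the sets in `𝒯`, and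
zero on all others. -/
noncomputable def hidden {n : ℕ} (k : ℕ) (𝒯 : Set (Finset (Fin n))) (S : Finset (Fin n)) : ℕ :=
  open Classical in if k < S.card ∨ S ∈ 𝒯 then 1 else 0

theorem monotone_hidden {n k : ℕ} {𝒯 : Set (Finset (Fin n))} (h𝒯 : ∀ T ∈ 𝒯, T.card = k) :
    Monotone (hidden k 𝒯) := by
  intro S S' hSS
  rw [hidden, hidden]
  split_ifs with h h' <;> try simp
  refine h' ?_
  rcases h with h | h
  · exact Or.inl (h.trans_le (Finset.card_le_card hSS))
  · rcases eq_or_ne S S' with rfl | hne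
    · exact Or.inr h
    · have := Finset.card_lt_card (hSS.ssubset_of_ne hne)
      exact Or.inl (by rw [← h𝒯 S h]; exact this)

theorem valueBits_hidden_le {n k : ℕ} (𝒯 : Set (Finset (Fin n))) : valueBits (hidden k 𝒯) ≤ 1 := by
  refine Finset.sup_le fun S _ => (length_bits_le _).trans ?_
  rw [hidden]
  split_ifs <;> simp

/-- No algorithm that asks polynomially many queries approximates all monotone functions: it cannot
tell the function that is zero on all `k`-sets from one that is positive on a single `k`-set. -/
theorem not_hasPolyTimeApprox_monotoneSetFunctions {c : ℝ} (hc : 0 < c) :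
    ¬ HasPolyTimeApprox monotoneSetFunctions c := by
  classical
  rintro ⟨p, q, hp⟩
  obtain ⟨k, hk⟩ := exists_eval_lt_centralBinom (q.comp (2 * .X + 1) + 1)
  simp only [Polynomial.eval_add, Polynomial.eval_comp, Polynomial.eval_mul, Polynomial.eval_ofNat,
    Polynomial.eval_X, Polynomial.eval_one] at hk
  have hkn : k ≤ 2 * k := by omega
  obtain ⟨s, t, hexec, ht, -⟩ :=
    hp (2 * k) k (hidden k ∅) hkn (monotone_hidden (by simp))
  have ht' : t ≤ q.eval (2 * k + 1) :=
    ht.trans (eval_mono q (by have := valueBits_hidden_le (n := 2 * k) (k := k) ∅; omega))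
  obtain ⟨Q, hQt, hQ⟩ := hexec.exists_queries
  -- There is a `k`-set which is neither queried nor returned.
  obtain ⟨T, hT, hTQ⟩ : ∃ T ∈ Finset.powersetCard k (Finset.univ : Finset (Fin (2 * k))),
      T ∉ insert (decodeSet (2 * k) (s 0)) (Q.image (decodeSet (2 * k))) := by
    refine Finset.exists_mem_notMem_of_card_lt_card ?_
    have h1 := Finset.card_insert_le (decodeSet (2 * k) (s 0)) (Q.image (decodeSet (2 * k)))
    have h2 := Finset.card_image_le (s := Q) (f := decodeSet (2 * k))
    rw [Finset.card_powersetCard, Finset.card_univ, Fintype.card_fin,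
      ← Nat.centralBinom_eq_two_mul_choose]
    omega
  rw [Finset.mem_powersetCard] at hT
  rw [Finset.mem_insert, Finset.mem_image, not_or, not_exists] at hTQ
  have hexec' := hQ (valueOracle (hidden k {T})) fun x hx => by
    have : decodeSet (2 * k) x ≠ T := fun h => hTQ.2 x ⟨hx, h⟩
    simp [valueOracle, hidden, this]
  obtain ⟨s', t', hexec'', -, hcard, hmax⟩ :=
    hp (2 * k) k (hidden k {T}) hkn (monotone_hidden (by simp [hT.2]))
  obtain rfl := hexec'.deterministic hexec''
  have h1 := hmax T hT.2.le
  have h2 : hidden k {T} (decodeSet (2 * k) (s 0)) = 0 := by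
    simp [hidden, hcard, Ne.symm hTQ.1]
  have h3 : hidden k {T} T = 1 := by simp [hidden]
  rw [h2, h3] at h1
  simp at h1
  linarith

end SSEHardness

theorem mainTheorem5 (hSSE : SSEHardness.SmallSetExpansionHypothesis) (c : ℝ) (hc : 0 < c) :
    ¬ SSEHardness.HasPolyTimeApprox SSEHardness.monotoneSetFunctions c ∧
    (SSEHardness.classP ≠ SSEHardness.classNP →
      ¬ SSEHardness.HasPolyTimeApprox SSEHardness.inducedEdgeCounts c) := by
  refine ⟨SSEHardness.not_hasPolyTimeApprox_monotoneSetFunctions hc, fun hne happrox => hne ?_⟩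
  obtain ⟨M, hM⟩ := exists_nat_gt (1 + 1 / c)
  have hM0 : (0 : ℝ) < M := lt_trans (by positivity) hM
  obtain ⟨δ, hδ, hδ', hhard⟩ := hSSE (1 / M) (by positivity)
  exact SSEHardness.classP_subset_classNP.antisymm
    (SSEHardness.classNP_subset_classP hc hM hδ hδ' hhard happrox)
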